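/- For integers $\ell,s,t\ge 2$, the double broom $B(\ell,s,t)$ is the tree obtained from a path $P_\ell$ on $\ell$ vertices by attaching $s$ pendant edges to one end vertex of $P_\ell$ and $t$ pendant edges to the other end vertex. For a graph $F$ and an integer $p\ge 2$, the edge blow-up $F^{p+1}$ is the graph obtained from $F$ by replacing each edge of $F$ by a clique of size $p+1$, where the new vertices of the cliques are all distinct. Let $\mathrm{ex}(n,F)$ be the maximum number of edges of a graph on $n$ vertices that does not contain $F$ as a (not necessarily induced) subgraph; an $F$-free graph on $n$ vertices with $\mathrm{ex}(n,F)$ edges is called extremal for $F$. Let $T(m,p)$ be the $p$-partite Turán graph on $m$ vertices (the complete $p$-partite graph whose class sizes differ by at most one), let $H(n,p,q)=K_{q-1}+T(n-q+1,p)$ be the join of the complete graph on $q-1$ vertices and $T(n-q+1,p)$, and let $h(n,p,q)$ be its number of edges. Let $p\ge 3$ and $k,s,t\ge 2$ be integers, and let $T=B(2k,s,t)$. Then there is an $N=N(p,k,s,t)$ such that for all $n\ge N$ $$\mathrm{ex}(n,T^{p+1})=h(n,p,k+1),$$ and $H(n,p,k+1)$ is, up to isomorphism, the unique extremal graph on $n$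 vertices for $T^{p+1}$. -/

import Mathlib

namespace EdgeBlowup

open SimpleGraph

/-- The join `G + H`: the disjoint union of `G` and `H` together with all edges between the two
vertex sets. -/
def join {V W : Type*} (G : SimpleGraph V) (H : SimpleGraph W) : SimpleGraph (V ⊕ W) :=
  (G ⊕g H) ⊔ completeBipartiteGraph V W

/-- The vertex set of the clique that replaces the edge `e` of `H`: the two ends of `e` and the
`m - 2` new vertices that belong to `e`. -/
def edgeClique {V : Type*} (H : SimpleGraph V) (m : ℕ) (e : H.edgeSet) :
    Set (V ⊕ H.edgeSet × Fin (m - 2)) :=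
  {x | Sum.elim (fun v => v ∈ (e : Sym2 V)) (fun a => a.1 = e) x}

/-- The edge blow-up `H^m`: each edge of `H` is replaced by a clique of size `m`, the new vertices
of the cliques being all distinct. (The blow-up `H^{p+1}` is the case `m = p + 1`.) -/
def edgeBlowup {V : Type*} (H : SimpleGraph V) (m : ℕ) :
    SimpleGraph (V ⊕ H.edgeSet × Fin (m - 2)) :=
  SimpleGraph.fromRel fun x y =>
    ∃ e : H.edgeSet, x ∈ edgeClique H m e ∧ y ∈ edgeClique H m e

/-- The double broom `B(ℓ, s, t)`: a path on the vertices `Fin ℓ`, with `s` pendant edges attached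
to its first vertex and `t` pendant edges attached to its last vertex. -/
def doubleBroom (ℓ s t : ℕ) : SimpleGraph (Fin ℓ ⊕ (Fin s ⊕ Fin t)) :=
  SimpleGraph.fromRel fun x y =>
    match x, y with
    | .inl i, .inl j => (pathGraph ℓ).Adj i j
    | .inl i, .inr (.inl _) => i.val = 0
    | .inl i, .inr (.inr _) => i.val + 1 = ℓ
    | .inr _, _ => False

/-- The graph `H(n, p, q) = K_{q-1} + T(n-q+1, p)`, where `T(m, p)` is the `p`-partite Turán graph
on `m` vertices; it has `n` vertices as soon as `q - 1 ≤ n`. -/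
def graphH (n p q : ℕ) : SimpleGraph (Fin (q - 1) ⊕ Fin (n - (q - 1))) :=
  join (completeGraph (Fin (q - 1))) (turanGraph (n - (q - 1)) p)

open Classical in
/-- `h(n, p, q) = e(H(n, p, q))`. -/
noncomputable def numH (n p q : ℕ) : ℕ :=
  (graphH n p q).edgeFinset.card

end EdgeBlowup

/-!
Let `T` be a bipartite graph with an independent set `S` of `k` vertices that misses exactly one
edge, such as every second vertex of the path of a double broom `B(2k, s, t)`, with one shift of
parity.

*Lower bound.* `T` has `k + 1` disjoint edges. Their cliques in the blow-up are disjoint, and each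
of them needs one of the `k` vertices of the complete part of `H(n, p, k + 1)`, since the Turán
graph has no clique of size `p + 1`.

*Upper bound.* Let `G` be free of the blow-up with at least as many edges as `H(n, p, k + 1)`.
Removing vertices of small degree increases the surplus of edges, so we may assume that the minimum
degree is at least `(1 - 1 / p) n - O(1)`. As the blow-up is `(p + 1)`-colourable, `G` is then
close to a Turán graph with classes `P i`. Call a vertex wide if it has linearly many neighbours in
every `P i`; there are boundedly many wide vertices. Every other vertex has few neighbours in some
`P i`, and a class together with its assigned vertices contains few disjoint edges, since a
matching of `|E(T)|` edges within one class extends to a copy of the blow-up. Hence the number of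
edges of `G` forces at least `k` wide vertices whose degree exceeds `(1 - 1 / p) n` linearly. They
can play the role of `S`, and then a further wide vertex, or an edge between two other vertices of
the same class, would complete the clique of the missed edge. So exactly `k` vertices are wide and
the remaining ones are coloured properly by the classes: `G` is contained in the join of `K_k` and
a `p`-partite graph, and the number of edges leaves only `H(n, p, k + 1)`.
-/

namespace EdgeBlowup

open SimpleGraph Finset

open scoped Classical

universe u

lemma exists_nat_forall_le_mul (c : ℝ) {ε : ℝ} (hε : 0 < ε) :
    ∃ N : ℕ, ∀ n : ℕ, N ≤ n → c ≤ ε * n := by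
  obtain ⟨N, hN⟩ := exists_nat_ge (c / ε)
  refine ⟨N, fun n hn => ?_⟩
  rw [div_le_iff₀' hε] at hN
  exact hN.trans (by gcongr)

section Neighbors

variable {V : Type*}

/-- The neighbours of `x` in the finite set `A`. -/
noncomputable def neighborsIn (G : SimpleGraph V) (x : V) (A : Finset V) : Finset V :=
  {y ∈ A | G.Adj x y}

/-- The vertices of the finite set `A` that are not adjacent to `x`, including `x` if it lies
in `A`. -/
noncomputable def nonNeighborsIn (G : SimpleGraph V) (x : V) (A : Finset V) : Finset V :=
  {y ∈ A | ¬ G.Adj x y}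

/-- The common neighbours in the finite set `A` of the vertices of `Z`. -/
noncomputable def commonNeighborsIn (G : SimpleGraph V) (Z A : Finset V) : Finset V :=
  {y ∈ A | ∀ z ∈ Z, G.Adj z y}

variable {G : SimpleGraph V} {x y : V} {A B Z Z' : Finset V}

lemma mem_neighborsIn : y ∈ neighborsIn G x A ↔ y ∈ A ∧ G.Adj x y := mem_filter

lemma mem_commonNeighborsIn : y ∈ commonNeighborsIn G Z A ↔ y ∈ A ∧ ∀ z ∈ Z, G.Adj z y :=
  mem_filter

lemma neighborsIn_subset : neighborsIn G x A ⊆ A := filter_subset _ _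

lemma commonNeighborsIn_subset : commonNeighborsIn G Z A ⊆ A := filter_subset _ _

lemma neighborsIn_mono (h : A ⊆ B) : neighborsIn G x A ⊆ neighborsIn G x B :=
  filter_subset_filter _ h

lemma nonNeighborsIn_mono (h : A ⊆ B) : nonNeighborsIn G x A ⊆ nonNeighborsIn G x B :=
  filter_subset_filter _ h

lemma commonNeighborsIn_anti (h : Z ⊆ Z') : commonNeighborsIn G Z' A ⊆ commonNeighborsIn G Z A :=
  fun _ hy => mem_filter.2 ⟨(mem_filter.1 hy).1, fun z hz => (mem_filter.1 hy).2 z (h hz)⟩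

lemma commonNeighborsIn_singleton : commonNeighborsIn G {x} A = neighborsIn G x A := by
  simp [commonNeighborsIn, neighborsIn]

lemma isCompleteBetween_commonNeighborsIn :
    G.IsCompleteBetween Z (commonNeighborsIn G Z A) :=
  fun _ hz _ hy => (mem_commonNeighborsIn.1 hy).2 _ hz

lemma card_neighborsIn_univ [Fintype V] : #(neighborsIn G x univ) = G.degree x := by
  rw [← card_neighborFinset_eq_degree, neighborFinset_eq_filter, neighborsIn]

lemma card_neighborsIn_add_card_nonNeighborsIn (G : SimpleGraph V) (x : V) (A : Finset V) :
    #(neighborsIn G x A) + #(nonNeighborsIn G x A) = #A :=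
  card_filter_add_card_filter_not _

lemma card_nonNeighborsIn_add_degree_le [Fintype V] (G : SimpleGraph V) (x : V) (A : Finset V) :
    #(nonNeighborsIn G x A) + G.degree x ≤ Fintype.card V := by
  have huniv := card_neighborsIn_add_card_nonNeighborsIn G x univ
  have hmono := card_le_card (nonNeighborsIn_mono (G := G) (x := x) (subset_univ A))
  rw [card_neighborsIn_univ, card_univ] at huniv
  omega

lemma card_neighborsIn_union_le :
    #(neighborsIn G x (A ∪ B)) ≤ #(neighborsIn G x A) + #(neighborsIn G x B) := by
  rw [neighborsIn, filter_union]
  exact card_union_le _ _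

lemma sum_card_neighborsIn_comm (G : SimpleGraph V) (A B : Finset V) :
    ∑ x ∈ A, #(neighborsIn G x B) = ∑ y ∈ B, #(neighborsIn G y A) := by
  have := sum_card_bipartiteAbove_eq_sum_card_bipartiteBelow (s := A) (t := B) G.Adj
  simpa [bipartiteAbove, bipartiteBelow, neighborsIn, G.adj_comm] using this

lemma sum_card_nonNeighborsIn_comm (G : SimpleGraph V) (A B : Finset V) :
    ∑ x ∈ A, #(nonNeighborsIn G x B) = ∑ y ∈ B, #(nonNeighborsIn G y A) := by
  have := sum_card_bipartiteAbove_eq_sum_card_bipartiteBelow (s := A) (t := B) (¬ G.Adj · ·)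
  simpa [bipartiteAbove, bipartiteBelow, nonNeighborsIn, G.adj_comm] using this

lemma card_le_card_commonNeighborsIn_add_sum (G : SimpleGraph V) (Z A : Finset V) :
    #A ≤ #(commonNeighborsIn G Z A) + ∑ z ∈ Z, #(nonNeighborsIn G z A) := by
  have hsub : A ⊆ commonNeighborsIn G Z A ∪ Z.biUnion fun z => nonNeighborsIn G z A := by
    intro y hy
    by_cases h : ∀ z ∈ Z, G.Adj z y
    · exact mem_union_left _ (mem_filter.2 ⟨hy, h⟩)
    · push Not at h
      obtain ⟨z, hz, hzy⟩ := h
      exact mem_union_right _ (mem_biUnion.2 ⟨z, hz, mem_filter.2 ⟨hy, hzy⟩⟩)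
  calc #A ≤ #(commonNeighborsIn G Z A) + #(Z.biUnion fun z => nonNeighborsIn G z A) :=
        (card_le_card hsub).trans (card_union_le _ _)
    _ ≤ _ := Nat.add_le_add_left card_biUnion_le _

lemma exists_le_card_filter_neighborsIn_eq {b : ℝ} (h : b * 2 ^ #B ≤ #A) :
    ∃ Q ⊆ B, b ≤ #{a ∈ A | neighborsIn G a B = Q} := by
  obtain ⟨Q, hQ, hb⟩ := exists_le_card_fiber_of_nsmul_le_card_of_maps_to (s := A)
    (t := B.powerset) (f := fun a => neighborsIn G a B) (b := b)
    (fun a _ => mem_powerset.2 neighborsIn_subset) (powerset_nonempty _)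
    (by simpa [mul_comm] using h)
  exact ⟨Q, mem_powerset.1 hQ, hb⟩

/-- Double counting of the edges between `B` and `A`. -/
lemma card_mul_le_card_mul_add_card_mul {d : ℝ} (m : ℕ)
    (hd : ∀ x ∈ B, d ≤ #(neighborsIn G x A)) :
    #B * d ≤ m * #A + #B * #{y ∈ A | m ≤ #(neighborsIn G y B)} := by
  have hlower : #B * d ≤ ∑ y ∈ A, (#(neighborsIn G y B) : ℝ) := by
    have hswap : ∑ y ∈ A, (#(neighborsIn G y B) : ℝ) = ∑ x ∈ B, (#(neighborsIn G x A) : ℝ) :=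
      mod_cast sum_card_neighborsIn_comm G A B
    rw [hswap, ← nsmul_eq_mul]
    exact card_nsmul_le_sum _ _ _ hd
  have hpoint : ∀ y ∈ A, #(neighborsIn G y B) ≤
      m + if m ≤ #(neighborsIn G y B) then #B else 0 := by
    intro y _
    have := card_le_card (neighborsIn_subset (G := G) (x := y) (A := B))
    split_ifs <;> omega
  have hupper : ∑ y ∈ A, #(neighborsIn G y B) ≤
      m * #A + #B * #{y ∈ A | m ≤ #(neighborsIn G y B)} := by
    refine (sum_le_sum hpoint).trans_eq ?_
    rw [sum_add_distrib, ← sum_filter]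
    simp [mul_comm]
  exact hlower.trans (mod_cast hupper)

lemma exists_card_eq_le_card_commonNeighborsIn {m : ℕ} {d : ℝ} (hd : 0 < d)
    (hdeg : ∀ w ∈ B, 2 * d ≤ #(neighborsIn G w A)) (hB : m * #A ≤ #B * d) (hB0 : B.Nonempty) :
    ∃ S ⊆ B, #S = m ∧ d / 2 ^ #B ≤ #(commonNeighborsIn G S A) := by
  set Y : Finset V := {y ∈ A | m ≤ #(neighborsIn G y B)}
  have hYd : d ≤ #Y := by
    have hcount := card_mul_le_card_mul_add_card_mul m hdeg
    have hBpos : (0 : ℝ) < #B := mod_cast hB0.card_pos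
    exact le_of_mul_le_mul_left (by linarith) hBpos
  obtain ⟨Q, hQB, hQ⟩ := exists_le_card_filter_neighborsIn_eq (G := G) (A := Y) (B := B)
    (b := d / 2 ^ #B) (by rwa [div_mul_cancel₀ _ (by positivity)])
  have hmQ : m ≤ #Q := by
    have hpos : (0 : ℝ) < #{a ∈ Y | neighborsIn G a B = Q} := lt_of_lt_of_le (by positivity) hQ
    obtain ⟨a, ha⟩ := card_pos.1 (Nat.cast_pos.1 hpos)
    obtain ⟨haY, rfl⟩ := mem_filter.1 ha
    exact (mem_filter.1 haY).2
  obtain ⟨S, hSQ, hS⟩ := exists_subset_card_eq hmQ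
  refine ⟨S, hSQ.trans hQB, hS, hQ.trans (mod_cast card_le_card fun y hy => ?_)⟩
  obtain ⟨hyY, rfl⟩ := mem_filter.1 hy
  exact mem_commonNeighborsIn.2
    ⟨(mem_filter.1 hyY).1, fun s hs => (mem_neighborsIn.1 (hSQ hs)).2.symm⟩

lemma exists_forall_le_card_commonNeighborsIn {η : ℝ} (hη : 0 < η) (m : ℕ) :
    ∃ c : ℕ, ∃ γ : ℝ, 0 < γ ∧ ∀ (V : Type u) [Fintype V] (G : SimpleGraph V) (A W : Finset V),
      c ≤ #W → (∀ w ∈ W, η * Fintype.card V ≤ #(neighborsIn G w A)) →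
      ∃ S ⊆ W, #S = m ∧ γ * Fintype.card V ≤ #(commonNeighborsIn G S A) := by
  obtain ⟨c, hc⟩ := exists_nat_ge (m / (η / 2))
  rw [div_le_iff₀ (by positivity)] at hc
  refine ⟨c + 1, η / 2 / 2 ^ (c + 1), by positivity, fun V _ G A W hW hdeg => ?_⟩
  obtain ⟨B, hBW, hB⟩ := exists_subset_card_eq hW
  have hB0 : B.Nonempty := card_pos.1 (by omega)
  have hn : (0 : ℝ) < Fintype.card V := mod_cast Fintype.card_pos_iff.2 hB0.to_type
  obtain ⟨S, hSB, hS, hcommon⟩ := exists_card_eq_le_card_commonNeighborsIn (G := G) (A := A)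
    (B := B) (m := m) (d := η / 2 * Fintype.card V) (by positivity)
    (fun w hw => by linarith [hdeg w (hBW hw)])
    (by
      have hA : (#A : ℝ) ≤ Fintype.card V := mod_cast card_le_univ A
      calc (m * #A : ℝ) ≤ (c * (η / 2)) * Fintype.card V := by gcongr
        _ ≤ #B * (η / 2 * Fintype.card V) := by
          rw [hB, mul_assoc]
          gcongr
          linarith) hB0
  refine ⟨S, hSB.trans hBW, hS, le_of_eq_of_le ?_ hcommon⟩
  rw [hB]
  ring

end Neighbors

section CompleteFamily

variable {V : Type*} {G : SimpleGraph V} {p m : ℕ}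

lemma completeEquipartiteGraph_isContained_of_pairwise {B : Fin p → Finset V}
    (hB : Pairwise fun i j => G.IsCompleteBetween (B i) (B j)) (hm : ∀ i, m ≤ #(B i)) :
    completeEquipartiteGraph p m ⊑ G := by
  have f (i : Fin p) : Fin m ↪ B i :=
    (Function.Embedding.nonempty_of_card_le (by simpa using hm i)).some
  refine ⟨⟨⟨fun a => (f a.1 a.2 : V), fun {a b} hab => hB (by simpa using hab) (f a.1 a.2).2
    (f b.1 b.2).2⟩, ?_⟩⟩
  rintro ⟨i, a⟩ ⟨j, b⟩ hab
  replace hab : (f i a : V) = f j b := hab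
  obtain rfl | hij := eq_or_ne i j
  · rw [(f i).injective (Subtype.ext hab)]
  · exact absurd hab (hB hij (f i a).2 (f j b).2).ne

lemma completeEquipartiteGraph_succ_isContained {A : Finset V} {B : Fin p → Finset V}
    (hB : Pairwise fun i j => G.IsCompleteBetween (B i) (B j))
    (hAB : ∀ i, G.IsCompleteBetween A (B i)) (hA : m ≤ #A) (hm : ∀ i, m ≤ #(B i)) :
    completeEquipartiteGraph (p + 1) m ⊑ G := by
  refine completeEquipartiteGraph_isContained_of_pairwise (B := Fin.cons A B) ?_
    (Fin.cases hA hm)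
  refine Fin.cases (Fin.cases (absurd rfl) fun j _ => hAB j) fun i => Fin.cases (fun _ => ?_) ?_
  · exact (hAB i).symm
  · exact fun j hij => hB (ne_of_apply_ne Fin.succ hij)

end CompleteFamily

section TypicalVertices

variable {V : Type*} [Fintype V] {G : SimpleGraph V} {p m s M : ℕ} {B : Fin p → Finset V}

/-- The vertices with at least `m` neighbours in every class of the family `B`. -/
noncomputable def richVertices (G : SimpleGraph V) (B : Fin p → Finset V) (m : ℕ) : Finset V :=
  {x | ∀ i, m ≤ #(neighborsIn G x (B i))}

/-- The vertices that resemble those of the class `B i` of the complete `p`-partite family `B`: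
they have fewer than `m` neighbours in `B i` and fewer than `s` non-neighbours in every other
class. -/
noncomputable def typicalVertices (G : SimpleGraph V) (B : Fin p → Finset V) (m s : ℕ)
    (i : Fin p) : Finset V :=
  {x | #(neighborsIn G x (B i)) < m ∧ ∀ j, j ≠ i → #(nonNeighborsIn G x (B j)) < s}

/-- The vertices that are neither rich nor typical for any class of `B`. -/
noncomputable def exceptionalVertices (G : SimpleGraph V) (B : Fin p → Finset V) (m s : ℕ) :
    Finset V :=
  univ \ (richVertices G B m ∪ univ.biUnion (typicalVertices G B m s))

lemma card_richVertices_le (hm : 0 < m) (hB : Pairwise fun i j => G.IsCompleteBetween (B i) (B j))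
    (hM : ∀ i, #(B i) ≤ M) (hfree : (completeEquipartiteGraph (p + 1) m).Free G) :
    #(richVertices G B m) ≤ m * 2 ^ (p * M) := by
  by_contra! hlt
  have hunion : #(univ.biUnion B) ≤ p * M := by
    simpa using card_biUnion_le_card_mul univ B M fun i _ => hM i
  obtain ⟨Q, -, hQ⟩ := exists_le_card_filter_neighborsIn_eq (G := G) (A := richVertices G B m)
    (B := univ.biUnion B) (b := m) <| by
      refine le_trans ?_ (Nat.cast_le.2 hlt.le)
      push_cast
      gcongr
      norm_num
  set A : Finset V := {a ∈ richVertices G B m | neighborsIn G a (univ.biUnion B) = Q}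
  have hAB : ∀ a ∈ A, ∀ i, neighborsIn G a (B i) = B i ∩ Q := by
    intro a ha i
    rw [← (mem_filter.1 ha).2]
    ext y
    simp only [mem_neighborsIn, mem_inter, mem_biUnion, mem_univ, true_and]
    exact ⟨fun h => ⟨h.1, ⟨i, h.1⟩, h.2⟩, fun h => ⟨h.1, h.2.2⟩⟩
  have hmA : m ≤ #A := mod_cast hQ
  obtain ⟨a, ha⟩ : A.Nonempty := card_pos.1 (by omega)
  refine hfree (completeEquipartiteGraph_succ_isContained (A := A) (B := fun i => B i ∩ Q)
    (fun i j hij x hx y hy => ?_) (fun i a ha y hy => ?_) hmA fun i => ?_)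
  · exact hB hij (mem_of_mem_inter_left hx) (mem_of_mem_inter_left hy)
  · rw [mem_coe, ← hAB a ha] at hy
    exact (mem_neighborsIn.1 hy).2
  · rw [← hAB a ha]
    exact (mem_filter.1 (mem_filter.1 ha).1).2 i

lemma pairwise_disjoint_typicalVertices (hB : ∀ i, m + s ≤ #(B i)) :
    Pairwise fun i j => Disjoint (typicalVertices G B m s i) (typicalVertices G B m s j) := by
  refine fun i j hij => Finset.disjoint_left.2 fun x hi hj => ?_
  have := card_neighborsIn_add_card_nonNeighborsIn G x (B j)
  have := (mem_filter.1 hi).2.2 j hij.symm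
  have := (mem_filter.1 hj).2.1
  have := hB j
  omega

lemma le_card_commonNeighborsIn_of_subset_typicalVertices {i j : Fin p} (hij : i ≠ j)
    {S : Finset V} (hS : S ⊆ typicalVertices G B m s i) (hB : m + #S * s ≤ #(B j)) :
    m ≤ #(commonNeighborsIn G S (B j)) := by
  have hcover := card_le_card_commonNeighborsIn_add_sum G S (B j)
  have hsum : ∑ x ∈ S, #(nonNeighborsIn G x (B j)) ≤ #S * s :=
    sum_le_card_nsmul _ _ _ fun x hx => ((mem_filter.1 (hS hx)).2.2 j hij.symm).le
  omega

variable {C : ℝ}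

lemma card_nonNeighborsIn_le_of_degree {x : V}
    (hdeg : (1 - 1 / p : ℝ) * Fintype.card V - C ≤ G.degree x) (A : Finset V) :
    (#(nonNeighborsIn G x A) : ℝ) ≤ Fintype.card V / p + C := by
  have h : (#(nonNeighborsIn G x A) + G.degree x : ℝ) ≤ Fintype.card V :=
    mod_cast card_nonNeighborsIn_add_degree_le G x A
  linarith [show (1 - 1 / p : ℝ) * Fintype.card V = Fintype.card V - Fintype.card V / p by ring]

lemma card_typicalVertices_mul_le {i : Fin p}
    (hdeg : ∀ v, (1 - 1 / p : ℝ) * Fintype.card V - C ≤ G.degree v) :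
    #(B i) * (#(typicalVertices G B m s i) - (Fintype.card V / p + C) : ℝ) ≤
      m * #(typicalVertices G B m s i) := by
  set U := typicalVertices G B m s i
  have hupper : ∑ b ∈ B i, #(neighborsIn G b U) ≤ #U * m := by
    rw [sum_card_neighborsIn_comm]
    exact sum_le_card_nsmul _ _ _ fun x hx => (mem_filter.1 hx).2.1.le
  have hlower : ∀ b ∈ B i, (#U - (Fintype.card V / p + C) : ℝ) ≤ #(neighborsIn G b U) := by
    intro b _
    have hsplit : (#(neighborsIn G b U) + #(nonNeighborsIn G b U) : ℝ) = #U :=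
      mod_cast card_neighborsIn_add_card_nonNeighborsIn G b U
    linarith [card_nonNeighborsIn_le_of_degree (hdeg b) U]
  calc #(B i) * (#U - (Fintype.card V / p + C) : ℝ)
      ≤ ∑ b ∈ B i, (#(neighborsIn G b U) : ℝ) := by
        rw [← nsmul_eq_mul]
        exact card_nsmul_le_sum _ _ _ hlower
    _ ≤ m * #U := by
        rw [mul_comm]
        exact mod_cast hupper

lemma add_le_sum_card_nonNeighborsIn_add (hB : ∀ i, #(B i) = M) (x : V) :
    M + (if x ∈ exceptionalVertices G B m s then s else 0) ≤
      ∑ i, #(nonNeighborsIn G x (B i)) + m + if x ∈ richVertices G B m then M else 0 := by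
  by_cases hrich : x ∈ richVertices G B m
  · simp [exceptionalVertices, hrich]
  obtain ⟨i, hi⟩ : ∃ i, #(neighborsIn G x (B i)) < m := by
    simpa [richVertices] using hrich
  have hsplit := card_neighborsIn_add_card_nonNeighborsIn G x (B i)
  rw [hB i] at hsplit
  rw [if_neg hrich]
  by_cases hx : x ∈ exceptionalVertices G B m s
  · obtain ⟨j, hji, hj⟩ : ∃ j ≠ i, s ≤ #(nonNeighborsIn G x (B j)) := by
      by_contra! h
      refine (mem_sdiff.1 hx).2 (mem_union_right _ (mem_biUnion.2 ⟨i, mem_univ i, ?_⟩))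
      exact mem_filter.2 ⟨mem_univ x, hi, h⟩
    have hpair := sum_le_univ_sum_of_nonneg (s := {i, j})
      (f := fun i => #(nonNeighborsIn G x (B i))) fun _ => Nat.zero_le _
    rw [sum_pair hji.symm] at hpair
    rw [if_pos hx]
    omega
  · have hsingle := single_le_sum_of_canonicallyOrdered
      (f := fun i => #(nonNeighborsIn G x (B i))) (mem_univ i)
    rw [if_neg hx]
    omega

lemma card_exceptionalVertices_mul_le (hp : 0 < p) (hB : ∀ i, #(B i) = M)
    (hdeg : ∀ v, (1 - 1 / p : ℝ) * Fintype.card V - C ≤ G.degree v) :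
    (#(exceptionalVertices G B m s) * s : ℝ) ≤
      m * Fintype.card V + #(richVertices G B m) * M + p * M * C := by
  have hcount : Fintype.card V * M + #(exceptionalVertices G B m s) * s ≤
      ∑ i, ∑ b ∈ B i, #(nonNeighborsIn G b univ) + Fintype.card V * m +
        #(richVertices G B m) * M := by
    have := sum_le_sum fun x (_ : x ∈ univ) =>
      add_le_sum_card_nonNeighborsIn_add (G := G) (m := m) (s := s) hB x
    simp only [sum_add_distrib, sum_ite_mem, univ_inter, sum_const, smul_eq_mul,
      card_univ] at this
    rwa [sum_comm, sum_congr rfl fun i _ => sum_card_nonNeighborsIn_comm G univ (B i)] at this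
  have hnon : ∑ i, ∑ b ∈ B i, (#(nonNeighborsIn G b univ) : ℝ) ≤
      Fintype.card V * M + p * M * C := by
    calc ∑ i, ∑ b ∈ B i, (#(nonNeighborsIn G b univ) : ℝ)
        ≤ ∑ i : Fin p, #(B i) • (Fintype.card V / p + C : ℝ) :=
          sum_le_sum fun i _ => sum_le_card_nsmul _ _ _ fun b _ =>
            card_nonNeighborsIn_le_of_degree (hdeg b) univ
      _ = Fintype.card V * M + p * M * C := by
          simp only [hB, sum_const, card_univ, Fintype.card_fin, nsmul_eq_mul]
          field_simp
  have hcount' : (Fintype.card V * M + #(exceptionalVertices G B m s) * s : ℝ) ≤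
      ∑ i, ∑ b ∈ B i, (#(nonNeighborsIn G b univ) : ℝ) + Fintype.card V * m +
        #(richVertices G B m) * M := mod_cast hcount
  linarith

lemma card_le_sum_card_typicalVertices (G : SimpleGraph V) (B : Fin p → Finset V) (m s : ℕ) :
    Fintype.card V ≤ ∑ i, #(typicalVertices G B m s i) + #(richVertices G B m) +
      #(exceptionalVertices G B m s) := by
  have hsdiff := le_card_sdiff (richVertices G B m ∪ univ.biUnion (typicalVertices G B m s)) univ
  have hunion := card_union_le (richVertices G B m) (univ.biUnion (typicalVertices G B m s))
  have hbiUnion := card_biUnion_le (s := univ) (t := typicalVertices G B m s)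
  rw [exceptionalVertices]
  rw [card_univ] at hsdiff
  omega

lemma card_typicalVertices_le {Q : ℕ} {ε : ℝ} {i : Fin p} (hm : 0 < m) (hQ : 1 < Q)
    (hB : #(B i) = m * Q) (hdeg : ∀ v, (1 - 1 / p : ℝ) * Fintype.card V - C ≤ G.degree v)
    (hcard : (Fintype.card V / p + Q * C : ℝ) ≤ ε * (Q - 1) * Fintype.card V) :
    (#(typicalVertices G B m s i) : ℝ) ≤ (1 / p + ε) * Fintype.card V := by
  set u := (#(typicalVertices G B m s i) : ℝ)
  have hQ' : (0 : ℝ) < Q - 1 := sub_pos.2 (mod_cast hQ)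
  have hu : Q * (u - (Fintype.card V / p + C)) ≤ u := by
    have h := card_typicalVertices_mul_le (m := m) (s := s) (B := B) (i := i) hdeg
    rw [hB, Nat.cast_mul, mul_assoc] at h
    exact le_of_mul_le_mul_left h (Nat.cast_pos.2 hm)
  refine le_of_mul_le_mul_left ?_ hQ'
  calc (Q - 1) * u ≤ (Q - 1) * (Fintype.card V / p) + (Fintype.card V / p + Q * C) := by linarith
    _ ≤ (Q - 1) * (Fintype.card V / p) + ε * (Q - 1) * Fintype.card V := by gcongr
    _ = (Q - 1) * ((1 / p + ε) * Fintype.card V) := by ring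

lemma le_sum_card_typicalVertices {K : ℕ} {ε : ℝ} (hp : 0 < p) (hm : 0 < m) (hC : 0 ≤ C)
    (hε : 0 ≤ ε) (hK : 2 ≤ ε * K) (hB : ∀ i, #(B i) = M)
    (hdeg : ∀ v, (1 - 1 / p : ℝ) * Fintype.card V - C ≤ G.degree v) {r : ℕ}
    (hr : #(richVertices G B m) ≤ r)
    (hcard : 2 * r + ε * (r * M + p * M * C) ≤ ε * Fintype.card V) :
    (1 - ε) * Fintype.card V ≤ ∑ i, (#(typicalVertices G B m (K * m) i) : ℝ) := by
  set y := (#(exceptionalVertices G B m (K * m)) : ℝ)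
  set a := (#(richVertices G B m) : ℝ)
  have har : a ≤ r := Nat.cast_le.2 hr
  have hm1 : (1 : ℝ) ≤ m := mod_cast hm
  have hyK : y * K ≤ Fintype.card V + (r * M + p * M * C) := by
    refine le_of_mul_le_mul_left ?_ (Nat.cast_pos.2 hm)
    calc m * (y * K) = y * (K * m : ℕ) := by push_cast; ring
      _ ≤ m * Fintype.card V + a * M + p * M * C := card_exceptionalVertices_mul_le hp hB hdeg
      _ ≤ m * Fintype.card V + 1 * (r * M + p * M * C) := by
        rw [one_mul, add_assoc]
        gcongr
      _ ≤ m * Fintype.card V + m * (r * M + p * M * C) := by gcongr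
      _ = m * (Fintype.card V + (r * M + p * M * C)) := by ring
  have hy : 2 * y ≤ ε * (Fintype.card V + (r * M + p * M * C)) :=
    calc 2 * y ≤ ε * K * y := by gcongr
      _ = ε * (y * K) := by ring
      _ ≤ _ := by gcongr
  have hsum : (Fintype.card V : ℝ) ≤
      ∑ i, (#(typicalVertices G B m (K * m) i) : ℝ) + a + y := by
    have h := card_le_sum_card_typicalVertices G B m (K * m)
    simp only [a, y]
    exact_mod_cast h
  linarith

end TypicalVertices

lemma exists_pairwise_isCompleteBetween (p M : ℕ) (hp : 2 ≤ p) (C : ℝ) :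
    ∃ N : ℕ, ∀ (V : Type u) [Fintype V] (G : SimpleGraph V), N ≤ Fintype.card V →
      (∀ v, (1 - 1 / p : ℝ) * Fintype.card V - C ≤ G.degree v) →
      ∃ B : Fin p → Finset V,
        (Pairwise fun i j => G.IsCompleteBetween (B i) (B j)) ∧ ∀ i, #(B i) = M := by
  obtain ⟨r, rfl⟩ := Nat.exists_eq_add_of_le' (one_le_two.trans hp)
  have hr : (0 : ℝ) < r := mod_cast (by omega : 0 < r)
  set ε : ℝ := (1 / r - 1 / (r + 1 : ℕ)) / 2 with hε_def
  have hε : 0 < ε := half_pos (sub_pos.2 (one_div_lt_one_div_of_lt hr (by simp)))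
  obtain ⟨N, hN⟩ := Filter.eventually_atTop.1
    (eventually_completeEquipartiteGraph_isContained_of_minDegree hε r M)
  obtain ⟨N', hN'⟩ := exists_nat_forall_le_mul C hε
  refine ⟨max 1 (max N N'), fun V _ G hn hdeg => ?_⟩
  have : NeZero (Fintype.card V) := ⟨by omega⟩
  let G' : SimpleGraph (Fin (Fintype.card V)) := G.map (Fintype.equivFin V).toEmbedding
  let ψ : G ≃g G' := Iso.map (Fintype.equivFin V) G
  have hmin : (G'.minDegree : ℝ) ≥ (1 - 1 / r + ε) * (Fintype.card V : ℕ) := by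
    obtain ⟨v, hv⟩ := G'.exists_minimal_degree_vertex
    obtain ⟨w, rfl⟩ := ψ.surjective v
    rw [hv, ψ.degree_eq]
    have hε_eq : (1 - 1 / r + ε) * (Fintype.card V : ℝ) =
        (1 - 1 / (r + 1 : ℕ)) * Fintype.card V - ε * Fintype.card V := by rw [hε_def]; ring
    linarith [hdeg w, hN' (Fintype.card V) (by omega)]
  obtain ⟨f⟩ := (hN (Fintype.card V) (by omega) hmin).trans ψ.isContained'
  refine ⟨fun i => univ.map ⟨fun j => f (i, j), fun a b hab => by simpa using f.injective hab⟩,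
    fun i j hij x hx y hy => ?_, by simp⟩
  obtain ⟨a, -, rfl⟩ := mem_map.1 hx
  obtain ⟨b, -, rfl⟩ := mem_map.1 hy
  exact f.toHom.map_adj (by simpa using hij)

lemma exists_types (p m : ℕ) (hp : 2 ≤ p) (hm : 0 < m) (C : ℝ) (hC : 0 ≤ C) {ε : ℝ} (hε : 0 < ε) :
    ∃ N : ℕ, ∀ (V : Type u) [Fintype V] (G : SimpleGraph V), N ≤ Fintype.card V →
      (∀ v, (1 - 1 / p : ℝ) * Fintype.card V - C ≤ G.degree v) →
      (completeEquipartiteGraph (p + 1) m).Free G →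
      ∃ B U : Fin p → Finset V, (Pairwise fun i j => G.IsCompleteBetween (B i) (B j)) ∧
        (Pairwise fun i j => Disjoint (U i) (U j)) ∧
        (∀ i j, i ≠ j → ∀ S ⊆ U i, #S ≤ 2 * m → m ≤ #(commonNeighborsIn G S (B j))) ∧
        (∀ i, (#(U i) : ℝ) ≤ (1 / p + ε) * Fintype.card V) ∧
        (1 - ε) * Fintype.card V ≤ ∑ i, (#(U i) : ℝ) := by
  obtain ⟨K, hK⟩ := exists_nat_ge (2 / ε)
  rw [div_le_iff₀' hε] at hK
  have hK0 : 0 < K := Nat.pos_of_ne_zero fun h => by norm_num [h] at hK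
  set Q : ℕ := 1 + K + 2 * m * K
  set r : ℕ := m * 2 ^ (p * (m * Q))
  obtain ⟨N₁, hN₁⟩ := exists_pairwise_isCompleteBetween.{u} p (m * Q) hp C
  obtain ⟨N₂, hN₂⟩ := exists_nat_forall_le_mul (2 * r + ε * (r * (m * Q) + p * (m * Q) * C)) hε
  obtain ⟨N₃, hN₃⟩ := exists_nat_forall_le_mul (Q * C) one_pos
  refine ⟨max N₁ (max N₂ N₃), fun V _ G hn hdeg hfree => ?_⟩
  obtain ⟨B, hB, hBcard⟩ := hN₁ V G (by omega) hdeg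
  refine ⟨B, typicalVertices G B m (K * m), hB,
    pairwise_disjoint_typicalVertices fun i => ?_, fun i j hij S hS hScard =>
      le_card_commonNeighborsIn_of_subset_typicalVertices hij hS ?_, fun i => ?_, ?_⟩
  · rw [hBcard]
    calc m + K * m ≤ m + K * m + m * (2 * m * K) := Nat.le_add_right _ _
      _ = m * Q := by ring
  · rw [hBcard]
    calc m + #S * (K * m) ≤ m + 2 * m * (K * m) := by gcongr
      _ ≤ m + 2 * m * (K * m) + m * K := Nat.le_add_right _ _
      _ = m * Q := by ring
  · refine card_typicalVertices_le hm (by omega) (hBcard i) hdeg ?_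
    have hnp : (Fintype.card V / p : ℝ) ≤ Fintype.card V :=
      div_le_self (by positivity) (mod_cast (by omega : 1 ≤ p))
    have hεQ : 2 ≤ ε * (Q - 1) :=
      hK.trans (mul_le_mul_of_nonneg_left (by push_cast [Q]; nlinarith) hε.le)
    calc (Fintype.card V / p + Q * C : ℝ) ≤ 2 * Fintype.card V := by
          linarith [hN₃ (Fintype.card V) (by omega)]
      _ ≤ _ := by gcongr
  · refine le_sum_card_typicalVertices (by omega) hm hC hε.le hK hBcard hdeg
      (card_richVertices_le hm hB (fun i => (hBcard i).le) hfree) ?_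
    exact mod_cast hN₂ (Fintype.card V) (by omega)

section NearlyComplete

/-- The family `P` of vertex classes is complete multipartite up to a defect `ξ`: every vertex of
a class has at most `ξ` non-neighbours in each other class. -/
def NearlyComplete {V : Type*} {p : ℕ} (G : SimpleGraph V) (P : Fin p → Finset V) (ξ : ℝ) : Prop :=
  ∀ ⦃i j⦄, i ≠ j → ∀ x ∈ P i, (#(nonNeighborsIn G x (P j)) : ℝ) ≤ ξ

lemma completeEquipartiteGraph_succ_isContained_of_union {V : Type*} {G : SimpleGraph V} {p m : ℕ}
    {B : Fin p → Finset V} (hB : Pairwise fun i j => G.IsCompleteBetween (B i) (B j))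
    {S T : Finset V} (hST : G.IsCompleteBetween S T) (hS : m ≤ #S) (hT : m ≤ #T) {i : Fin p}
    (hcommon : ∀ j, i ≠ j → m ≤ #(commonNeighborsIn G (S ∪ T) (B j))) :
    completeEquipartiteGraph (p + 1) m ⊑ G := by
  set R : Fin p → Finset V := Function.update (fun j => commonNeighborsIn G (S ∪ T) (B j)) i T
  have hRi : R i = T := Function.update_self ..
  have hRj : ∀ j, i ≠ j → R j = commonNeighborsIn G (S ∪ T) (B j) := fun j hij =>
    Function.update_of_ne hij.symm ..
  have hleft : ∀ j, i ≠ j → G.IsCompleteBetween (S ∪ T : Finset V) (R j) := fun j hij => by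
    rw [hRj j hij]
    exact isCompleteBetween_commonNeighborsIn
  refine completeEquipartiteGraph_succ_isContained (A := S) (B := R) (fun j l hjl => ?_)
    (fun j => ?_) hS fun j => ?_
  · obtain rfl | hij := eq_or_ne i j
    · exact fun x hx y hy => hleft l hjl (mem_union_right _ (hRi ▸ hx)) hy
    obtain rfl | hil := eq_or_ne i l
    · exact fun x hx y hy => (hleft j hij (mem_union_right _ (hRi ▸ hy)) hx).symm
    · rw [hRj j hij, hRj l hil]
      exact fun x hx y hy => hB hjl (commonNeighborsIn_subset hx) (commonNeighborsIn_subset hy)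
  · obtain rfl | hij := eq_or_ne i j
    · rwa [hRi]
    · exact fun x hx y hy => hleft j hij (mem_union_left _ hx) hy
  · obtain rfl | hij := eq_or_ne i j
    · rwa [hRi]
    · rw [hRj j hij]
      exact hcommon j hij

lemma exists_card_filter_le_card_neighborsIn_lt (m : ℕ) {δ : ℝ} (hδ : 0 < δ) :
    ∃ c N : ℕ, ∀ (V : Type u) [Fintype V] (G : SimpleGraph V), N ≤ Fintype.card V →
      ∀ {p : ℕ} {B : Fin p → Finset V}, (Pairwise fun i j => G.IsCompleteBetween (B i) (B j)) →
      (completeEquipartiteGraph (p + 1) m).Free G → ∀ {U : Finset V} {i : Fin p},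
      (∀ j, i ≠ j → ∀ S ⊆ U, #S ≤ 2 * m → m ≤ #(commonNeighborsIn G S (B j))) →
      #{x ∈ U | δ * Fintype.card V ≤ #(neighborsIn G x U)} < c := by
  obtain ⟨c, γ, hγ, hc⟩ := exists_forall_le_card_commonNeighborsIn.{u} hδ m
  obtain ⟨N, hN⟩ := exists_nat_forall_le_mul m hγ
  refine ⟨c, N, fun V _ G hn p B hB hfree U i hU => ?_⟩
  by_contra! hcard
  obtain ⟨S, hSW, hS, hScommon⟩ := hc V G U _ hcard fun w hw => (mem_filter.1 hw).2
  obtain ⟨T, hT, hTcard⟩ := exists_subset_card_eq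
    (Nat.cast_le.1 ((hN _ hn).trans hScommon) : m ≤ #(commonNeighborsIn G S U))
  refine hfree (completeEquipartiteGraph_succ_isContained_of_union (i := i) hB
    (fun x hx y hy => isCompleteBetween_commonNeighborsIn hx (hT hy)) hS.ge hTcard.ge
    fun j hij => hU j hij _ (union_subset ?_ (hT.trans commonNeighborsIn_subset)) ?_)
  · exact hSW.trans (filter_subset _ _)
  · have := card_union_le S T
    omega

variable {V : Type*} {p : ℕ} {U : Fin p → Finset V}

lemma sub_mul_le_card_of_sum_ge {r ξ : ℝ} (hupper : ∀ i, (#(U i) : ℝ) ≤ r + ξ)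
    (hsum : p * r - ξ ≤ ∑ i, (#(U i) : ℝ)) (i : Fin p) : r - p * ξ ≤ #(U i) := by
  have herase : ∑ j ∈ univ.erase i, (#(U j) : ℝ) ≤ (p - 1) * (r + ξ) := by
    have := sum_le_card_nsmul (univ.erase i) (fun j => (#(U j) : ℝ)) _ fun j _ => hupper j
    rwa [card_erase_of_mem (mem_univ i), card_univ, Fintype.card_fin, nsmul_eq_mul,
      Nat.cast_sub i.pos, Nat.cast_one] at this
  linarith [add_sum_erase univ (fun j => (#(U j) : ℝ)) (mem_univ i)]

lemma card_nonNeighborsIn_le_of_card_neighborsIn_lt [Fintype V] {G : SimpleGraph V}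
    {a b C : ℝ} {x : V} {i j : Fin p}
    (hdisj : Disjoint (U i) (U j)) (hdeg : (1 - 1 / p : ℝ) * Fintype.card V - C ≤ G.degree x)
    (hUi : Fintype.card V / p - a ≤ (#(U i) : ℝ)) (hx : (#(neighborsIn G x (U i)) : ℝ) < b) :
    (#(nonNeighborsIn G x (U j)) : ℝ) ≤ a + b + C := by
  have hunion := card_nonNeighborsIn_le_of_degree hdeg (U i ∪ U j)
  rw [nonNeighborsIn, filter_union,
    card_union_of_disjoint (disjoint_filter_filter hdisj)] at hunion
  have hsplit : (#(neighborsIn G x (U i)) + #(nonNeighborsIn G x (U i)) : ℝ) = #(U i) :=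
    mod_cast card_neighborsIn_add_card_nonNeighborsIn G x (U i)
  unfold nonNeighborsIn at hsplit ⊢
  push_cast at hunion
  linarith

/-- The graph `G` is close to a Turán graph with classes `P i`: it has large minimum degree, and
the classes are nearly balanced, cover nearly all vertices and are nearly completely joined to each
other. The errors `ξ` and `C` are absolute, not relative to the number of vertices. -/
structure NearTuran {V : Type*} [Fintype V] {p : ℕ} (G : SimpleGraph V) (P : Fin p → Finset V)
    (ξ C : ℝ) : Prop where
  disjoint : Pairwise fun i j => Disjoint (P i) (P j)
  nearlyComplete : NearlyComplete G P ξ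
  card_le : ∀ i, (#(P i) : ℝ) ≤ Fintype.card V / p + ξ
  le_sum_card : Fintype.card V - ξ ≤ ∑ i, (#(P i) : ℝ)
  le_degree : ∀ v, (1 - 1 / p : ℝ) * Fintype.card V - C ≤ G.degree v

end NearlyComplete

lemma exists_nearTuran (p m : ℕ) (hp : 2 ≤ p) (hm : 0 < m) (C : ℝ) (hC : 0 ≤ C) {ε : ℝ}
    (hε : 0 < ε) :
    ∃ N : ℕ, ∀ (V : Type u) [Fintype V] (G : SimpleGraph V), N ≤ Fintype.card V →
      (∀ v, (1 - 1 / p : ℝ) * Fintype.card V - C ≤ G.degree v) →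
      (completeEquipartiteGraph (p + 1) m).Free G →
      ∃ P : Fin p → Finset V, NearTuran G P (ε * Fintype.card V) C := by
  have hp₀ : (0 : ℝ) < p := mod_cast (by omega : 0 < p)
  obtain ⟨δ, hδ, hδε⟩ : ∃ δ : ℝ, 0 < δ ∧ (p + 1) * δ = ε / 2 :=
    ⟨ε / (2 * (p + 1)), by positivity, by field_simp⟩
  have hδε' : δ ≤ ε / 2 := by nlinarith
  obtain ⟨N₁, hN₁⟩ := exists_types.{u} p m hp hm C hC hδ
  obtain ⟨c, N₂, hN₂⟩ := exists_card_filter_le_card_neighborsIn_lt.{u} m hδ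
  obtain ⟨N₃, hN₃⟩ := exists_nat_forall_le_mul C (half_pos hε)
  obtain ⟨N₄, hN₄⟩ := exists_nat_forall_le_mul (p * c) (half_pos hε)
  refine ⟨max N₁ (max N₂ (max N₃ N₄)), fun V _ G hn hdeg hfree => ?_⟩
  obtain ⟨B, U, hB, hdisj, hcommon, hupper, hsum⟩ := hN₁ V G (by omega) hdeg hfree
  replace hN₃ := hN₃ (Fintype.card V) (by omega)
  replace hN₄ := hN₄ (Fintype.card V) (by omega)
  set n := (Fintype.card V : ℝ)
  have : 0 ≤ ε * n := by positivity
  have hδn : δ * n ≤ ε / 2 * n := by gcongr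
  have hδεn : p * (δ * n) + δ * n = ε / 2 * n := by rw [← hδε]; ring
  replace hupper : ∀ i, (#(U i) : ℝ) ≤ n / p + δ * n := fun i => (hupper i).trans_eq (by ring)
  have hlower := sub_mul_le_card_of_sum_ge hupper (by rw [mul_div_cancel₀ _ hp₀.ne']; linarith)
  set D : Fin p → Finset V := fun i => {x ∈ U i | δ * n ≤ #(neighborsIn G x (U i))}
  have hDcard : ∀ i, #(D i) < c := fun i =>
    hN₂ V G (by omega) hB hfree fun j hij => hcommon i j hij
  refine ⟨fun i => U i \ D i, fun i j hij => (hdisj hij).mono sdiff_subset sdiff_subset,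
    fun i j hij x hx => ?_, fun i => ?_, ?_, hdeg⟩
  · have hxD : (#(neighborsIn G x (U i)) : ℝ) < δ * n :=
      lt_of_not_ge fun h => (mem_sdiff.1 hx).2 (mem_filter.2 ⟨(mem_sdiff.1 hx).1, h⟩)
    calc (#(nonNeighborsIn G x (U j \ D j)) : ℝ) ≤ #(nonNeighborsIn G x (U j)) :=
          mod_cast card_le_card (nonNeighborsIn_mono sdiff_subset)
      _ ≤ p * (δ * n) + δ * n + C :=
          card_nonNeighborsIn_le_of_card_neighborsIn_lt (hdisj hij) (hdeg x) (hlower i) hxD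
      _ ≤ ε * n := by linarith
  · calc (#(U i \ D i) : ℝ) ≤ #(U i) := mod_cast card_le_card sdiff_subset
      _ ≤ n / p + ε * n := by linarith [hupper i]
  · have hsdiff : ∑ i, (#(U i) : ℝ) ≤ ∑ i, (#(U i \ D i) : ℝ) + p * c := by
      have hpoint : ∀ i ∈ univ, (#(U i) : ℝ) ≤ #(U i \ D i) + c := fun i _ =>
        mod_cast (tsub_le_iff_right.1 (le_card_sdiff (D i) (U i))).trans
          (Nat.add_le_add_left (hDcard i).le _)
      simpa [sum_add_distrib] using sum_le_sum hpoint
    linarith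

section Embedding

variable {V : Type*} {G : SimpleGraph V} {p : ℕ} {P : Fin p → Finset V} {ξ : ℝ}

lemma exists_mem_forall_ne_and_adj {ι : Type*} (hP : NearlyComplete G P ξ) (hξ : 0 ≤ ξ)
    {c : ι → Fin p} {f : ι → V} {s : Finset ι} (hf : ∀ v ∈ s, f v ∈ P (c v)) {i : Fin p}
    {A : Finset V} (hA : A ⊆ P i) (hcard : #s * (ξ + 1) < #A) :
    ∃ y ∈ A, ∀ v ∈ s, f v ≠ y ∧ (c v ≠ i → G.Adj (f v) y) := by
  set Z : ι → Finset V := fun v =>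
    insert (f v) (if c v = i then ∅ else nonNeighborsIn G (f v) (P i))
  have hZ : ∀ v ∈ s, (#(Z v) : ℝ) ≤ ξ + 1 := fun v hv => by
    have hinsert : (#(Z v) : ℝ) ≤
        #(if c v = i then ∅ else nonNeighborsIn G (f v) (P i)) + 1 :=
      mod_cast card_insert_le _ _
    refine hinsert.trans (add_le_add_left ?_ 1)
    split_ifs with h
    · simpa using hξ
    · exact hP h _ (hf v hv)
  have hlt : #(s.biUnion Z) < #A := by
    refine Nat.cast_lt (α := ℝ).1 (lt_of_le_of_lt ?_ hcard)
    calc (#(s.biUnion Z) : ℝ) ≤ ∑ v ∈ s, (#(Z v) : ℝ) := mod_cast card_biUnion_le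
      _ ≤ #s * (ξ + 1) := by simpa [mul_add] using sum_le_card_nsmul s _ _ hZ
  obtain ⟨y, hyA, hyZ⟩ := exists_mem_notMem_of_card_lt_card hlt
  refine ⟨y, hyA, fun v hv => ⟨?_, fun hvi => by_contra fun hadj => ?_⟩⟩
  · rintro rfl
    exact hyZ (mem_biUnion.2 ⟨v, hv, mem_insert_self _ _⟩)
  · refine hyZ (mem_biUnion.2 ⟨v, hv, mem_insert_of_mem ?_⟩)
    rw [if_neg hvi]
    exact mem_filter.2 ⟨hA hyA, hadj⟩

lemma exists_transversal {ι : Type*} (hP : NearlyComplete G P ξ) (hξ : 0 ≤ ξ) (c : ι → Fin p)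
    (f₀ : ι → V) {A : ι → Finset V} (s : Finset ι) (hA : ∀ u ∈ s, A u ⊆ P (c u))
    (hcard : ∀ u ∈ s, #s * (ξ + 1) < #(A u)) :
    ∃ f : ι → V, (∀ u ∉ s, f u = f₀ u) ∧ Set.InjOn f s ∧ (∀ u ∈ s, f u ∈ A u) ∧
      ∀ u ∈ s, ∀ v ∈ s, c u ≠ c v → G.Adj (f u) (f v) := by
  induction s using Finset.induction_on with
  | empty => exact ⟨f₀, by simp⟩
  | insert a s ha ih =>
    have hlt : ∀ u ∈ insert a s, #s * (ξ + 1) < #(A u) := fun u hu =>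
      lt_of_le_of_lt (by gcongr; exact subset_insert a s) (hcard u hu)
    obtain ⟨f, hf₀, hinj, hfA, hadj⟩ := ih (fun u hu => hA u (mem_insert_of_mem hu))
      fun u hu => hlt u (mem_insert_of_mem hu)
    obtain ⟨y, hyA, hy⟩ := exists_mem_forall_ne_and_adj (c := c) hP hξ
      (fun v hv => hA v (mem_insert_of_mem hv) (hfA v hv)) (hA a (mem_insert_self a s))
      (hlt a (mem_insert_self a s))
    have hs : ∀ u ∈ s, Function.update f a y u = f u := fun u hu =>
      Function.update_of_ne (ne_of_mem_of_not_mem hu ha) _ _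
    refine ⟨Function.update f a y, fun u hu => ?_, ?_, fun u hu => ?_, fun u hu v hv huv => ?_⟩
    · rw [mem_insert, not_or] at hu
      rw [Function.update_of_ne hu.1, hf₀ u hu.2]
    · rw [coe_insert, Set.injOn_insert (mem_coe.not.2 ha), Function.update_self]
      refine ⟨hinj.congr fun u hu => (hs u hu).symm, ?_⟩
      rintro ⟨v, hv, hvy⟩
      exact (hy v hv).1 ((hs v hv).symm.trans hvy)
    · obtain rfl | hu := mem_insert.1 hu
      · rwa [Function.update_self]
      · rw [hs u hu]
        exact hfA u hu
    · rw [mem_insert] at hu hv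
      obtain rfl | hu := hu <;> obtain rfl | hv := hv
      · exact absurd rfl huv
      · rw [hs v hv, Function.update_self]
        exact ((hy v hv).2 huv.symm).symm
      · rw [hs u hu, Function.update_self]
        exact (hy u hu).2 huv
      · rw [hs u hu, hs v hv]
        exact hadj u hu v hv huv

lemma isContained_of_le_card_commonNeighborsIn {U : Type*} [Fintype U] {F : SimpleGraph U}
    (hP : NearlyComplete G P ξ) (hξ : 0 ≤ ξ) {S : Finset U} {ψ : U → V} {c : U → Fin p}
    (hinj : Set.InjOn ψ S) (hadj : ∀ u ∈ S, ∀ v ∈ S, F.Adj u v → G.Adj (ψ u) (ψ v))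
    (hcol : ∀ u ∉ S, ∀ v ∉ S, F.Adj u v → c u ≠ c v)
    (hcard : ∀ u ∉ S, Fintype.card U * (ξ + 2) <
      #(commonNeighborsIn G ({v ∈ S | F.Adj v u}.image ψ) (P (c u)))) : F ⊑ G := by
  set A : U → Finset V := fun u =>
    commonNeighborsIn G ({v ∈ S | F.Adj v u}.image ψ) (P (c u)) \ univ.image ψ
  obtain ⟨f, hfS, hfinj, hfA, hfadj⟩ := exists_transversal (A := A) hP hξ c ψ Sᶜ
    (fun u _ => sdiff_subset.trans commonNeighborsIn_subset) fun u hu => by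
      have hsdiff : (#(commonNeighborsIn G ({v ∈ S | F.Adj v u}.image ψ) (P (c u))) : ℝ) ≤
          #(A u) + Fintype.card U := mod_cast (tsub_le_iff_right.1 (le_card_sdiff _ _)).trans
            (Nat.add_le_add_left card_image_le _)
      have hcompl : #Sᶜ * (ξ + 1) ≤ Fintype.card U * (ξ + 1) := by
        gcongr
        exact card_le_univ _
      linarith [hcard u (mem_compl.1 hu)]
  simp only [mem_compl, not_not] at hfS hfA hfadj
  have hSf : ∀ u ∈ S, ∀ v ∉ S, f u ≠ f v ∧ (F.Adj u v → G.Adj (f u) (f v)) := by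
    intro u hu v hv
    obtain ⟨hcommon, hnotMem⟩ := mem_sdiff.1 (hfA v hv)
    rw [hfS u hu]
    exact ⟨fun h => hnotMem (h ▸ mem_image_of_mem ψ (mem_univ u)), fun huv =>
      (mem_commonNeighborsIn.1 hcommon).2 _ (mem_image_of_mem ψ (mem_filter.2 ⟨hu, huv⟩))⟩
  refine ⟨⟨⟨f, fun {u v} huv => ?_⟩, fun u v huv => ?_⟩⟩
  · by_cases hu : u ∈ S <;> by_cases hv : v ∈ S
    · rw [hfS u hu, hfS v hv]
      exact hadj u hu v hv huv
    · exact (hSf u hu v hv).2 huv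
    · exact ((hSf v hv u hu).2 huv.symm).symm
    · exact hfadj u hu v hv (hcol u hu v hv huv)
  · change f u = f v at huv
    by_cases hu : u ∈ S <;> by_cases hv : v ∈ S
    · exact hinj hu hv (by rwa [hfS u hu, hfS v hv] at huv)
    · exact absurd huv (hSf u hu v hv).1
    · exact absurd huv.symm (hSf v hv u hu).1
    · exact hfinj (by simpa using hu) (by simpa using hv) huv

end Embedding

section EdgeBlowup

variable {τ : Type*} {T : SimpleGraph τ} {m : ℕ} {u v : τ} {e f : T.edgeSet} {i j : Fin (m - 2)}

lemma edgeBlowup_adj {x y : τ ⊕ T.edgeSet × Fin (m - 2)} :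
    (edgeBlowup T m).Adj x y ↔
      x ≠ y ∧ ∃ e : T.edgeSet, x ∈ edgeClique T m e ∧ y ∈ edgeClique T m e := by
  simp only [edgeBlowup, fromRel_adj, and_comm (a := y ∈ _), or_self]

@[simp]
lemma edgeBlowup_adj_inl_inl : (edgeBlowup T m).Adj (.inl u) (.inl v) ↔ T.Adj u v := by
  simp only [edgeBlowup_adj, ne_eq, Sum.inl.injEq]
  refine ⟨?_, fun h => ⟨h.ne, ⟨s(u, v), h⟩, Sym2.mem_mk_left u v, Sym2.mem_mk_right u v⟩⟩
  rintro ⟨huv, e, hu, hv⟩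
  rw [← mem_edgeSet, ← (Sym2.mem_and_mem_iff huv).1 ⟨hu, hv⟩]
  exact e.2

@[simp]
lemma edgeBlowup_adj_inl_inr :
    (edgeBlowup T m).Adj (.inl u) (.inr (e, i)) ↔ u ∈ (e : Sym2 τ) := by
  simp [edgeBlowup_adj, edgeClique]

@[simp]
lemma edgeBlowup_adj_inr_inl :
    (edgeBlowup T m).Adj (.inr (e, i)) (.inl u) ↔ u ∈ (e : Sym2 τ) := by
  rw [adj_comm, edgeBlowup_adj_inl_inr]

@[simp]
lemma edgeBlowup_adj_inr_inr :
    (edgeBlowup T m).Adj (.inr (e, i)) (.inr (f, j)) ↔ e = f ∧ i ≠ j := by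
  simp only [edgeBlowup_adj, edgeClique, Set.mem_ofPred_eq, Sum.elim_inr, ne_eq, Sum.inr.injEq,
    Prod.mk.injEq]
  grind

end EdgeBlowup

lemma exists_mapsTo_injOn_of_card_le {α β : Type*} [Nonempty β] {s : Finset α} {t : Finset β}
    (h : #s ≤ #t) : ∃ f : α → β, (∀ x ∈ s, f x ∈ t) ∧ Set.InjOn f s :=
  s.finite_toSet.exists_injOn_of_encard_le (t := (t : Set β)) (by
    simpa only [Set.encard_coe_eq_coe_finsetCard, Nat.cast_le] using h)

section PartialPlacement

variable {τ V : Type*} {T : SimpleGraph τ} {G : SimpleGraph V} {p g : ℕ} {S : Finset τ} {ψ : τ → V}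
  {Q : T.edgeSet → Finset V} {c : τ → Fin p} {I : Finset (Fin p)} {P : Fin p → Finset V}

/-- The edges of `T` without an end in `S`. -/
def missedEdges (T : SimpleGraph τ) (S : Finset τ) : Set T.edgeSet :=
  {e | ∀ u ∈ (e : Sym2 τ), u ∉ S}

lemma mem_missedEdges {e : T.edgeSet} : e ∈ missedEdges T S ↔ ∀ u ∈ (e : Sym2 τ), u ∉ S := Iff.rfl

/-- The vertices of the blow-up `T ^ (p + 1)` that are prescribed by a `PartialPlacement`: those
of `S`, and the first `g` new vertices of each missed edge. -/
noncomputable def placedVertices [Fintype τ] (T : SimpleGraph τ) (S : Finset τ) (p g : ℕ) :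
    Finset (τ ⊕ T.edgeSet × Fin (p + 1 - 2)) :=
  {x | Sum.elim (· ∈ S) (fun a => a.1 ∈ missedEdges T S ∧ a.2 < g) x}

lemma inl_mem_placedVertices [Fintype τ] {u : τ} : .inl u ∈ placedVertices T S p g ↔ u ∈ S := by
  simp [placedVertices]

lemma inr_mem_placedVertices [Fintype τ] {e : T.edgeSet} {i : Fin (p + 1 - 2)} :
    .inr (e, i) ∈ placedVertices T S p g ↔ e ∈ missedEdges T S ∧ i < g := by
  simp [placedVertices]

/-- The data from which a copy of the blow-up `T ^ (p + 1)` in `G` is built: the vertices of the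
independent set `S` are placed by `ψ`, the clique of an edge `e` missed by `S` uses the vertices
`Q e` as `g` of its new vertices, and the colours `c` tell in which of `p` vertex classes the
vertices of `T` outside `S` are to be placed. The other vertices of the clique of a missed edge go
to classes with index in `I`. -/
structure PartialPlacement (T : SimpleGraph τ) (G : SimpleGraph V) (S : Finset τ) (ψ : τ → V)
    (g : ℕ) (Q : T.edgeSet → Finset V) (c : τ → Fin p) (I : Finset (Fin p)) : Prop where
  indep : ∀ u ∈ S, ∀ v ∈ S, ¬ T.Adj u v
  injOn : Set.InjOn ψ S
  isNClique : ∀ e ∈ missedEdges T S, G.IsNClique g (Q e)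
  pairwiseDisjoint : (missedEdges T S).PairwiseDisjoint Q
  notMem : ∀ e ∈ missedEdges T S, ∀ s ∈ S, ψ s ∉ Q e
  color_ne : ∀ u ∉ S, ∀ v ∉ S, T.Adj u v → c u ≠ c v
  color_mem : ∀ u ∉ S, ∀ v ∉ S, T.Adj u v → c u ∈ I
  le_card : p + 1 ≤ #I + g

namespace PartialPlacement

variable (h : PartialPlacement T G S ψ g Q c I) (e : T.edgeSet)

include h

lemma exists_color :
    ∃ γ : Fin (p + 1 - 2) → Fin p, Set.InjOn γ {i | e ∈ missedEdges T S → g ≤ i} ∧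
      ∀ i : Fin (p + 1 - 2), (e ∈ missedEdges T S → g ≤ i) →
        (∀ u ∈ (e : Sym2 τ), u ∉ S → γ i ≠ c u) ∧ (e ∈ missedEdges T S → γ i ∈ I) := by
  obtain ⟨⟨x, y⟩, hxy : T.Adj x y⟩ := e
  have : Nonempty (Fin p) := ⟨c x⟩
  by_cases he : ⟨s(x, y), hxy⟩ ∈ missedEdges T S
  · have hx : x ∉ S := he x (Sym2.mem_mk_left x y)
    have hy : y ∉ S := he y (Sym2.mem_mk_right x y)
    have hcard : #{i : Fin (p + 1 - 2) | g ≤ i} ≤ #((I.erase (c x)).erase (c y)) := by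
      rw [card_erase_of_mem (mem_erase.2 ⟨(h.color_ne x hx y hy hxy).symm,
        h.color_mem y hy x hx hxy.symm⟩), card_erase_of_mem (h.color_mem x hx y hy hxy)]
      have hlt := card_filter_add_card_filter_not (s := (univ : Finset (Fin (p + 1 - 2))))
        fun i => i.1 < g
      simp only [not_lt, card_univ, Fintype.card_fin, Fin.card_filter_val_lt] at hlt
      have := h.le_card
      omega
    obtain ⟨γ, hγ, hinj⟩ := exists_mapsTo_injOn_of_card_le hcard
    simp only [mem_filter, mem_univ, true_and, mem_erase] at hγ
    refine ⟨γ, by simpa [he] using hinj, fun i hi =>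
      ⟨fun u hu _ => ?_, fun _ => (hγ i (hi he)).2.2⟩⟩
    obtain rfl | rfl := Sym2.mem_iff.1 hu
    exacts [(hγ i (hi he)).2.1, (hγ i (hi he)).1]
  · obtain ⟨z, hz⟩ : ∃ z, ∀ u ∈ s(x, y), u ∉ S → u = z := by
      have hmeets : x ∈ S ∨ y ∈ S := by
        by_contra! hmissed
        exact he fun u hu => by obtain rfl | rfl := Sym2.mem_iff.1 hu <;> simp [hmissed]
      obtain hx | hy := hmeets
      · exact ⟨y, fun u hu huS => (Sym2.mem_iff.1 hu).resolve_left (by rintro rfl; exact huS hx)⟩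
      · exact ⟨x, fun u hu huS => (Sym2.mem_iff.1 hu).resolve_right (by rintro rfl; exact huS hy)⟩
    have hcard : #(univ : Finset (Fin (p + 1 - 2))) ≤ #((univ : Finset (Fin p)).erase (c z)) := by
      simp [card_erase_of_mem]
    obtain ⟨γ, hγ, hinj⟩ := exists_mapsTo_injOn_of_card_le hcard
    refine ⟨γ, by simpa [he] using hinj, fun i _ => ⟨fun u hu huS => ?_, fun h => absurd h he⟩⟩
    rw [hz u hu huS]
    exact ne_of_mem_erase (hγ i (mem_univ i))

lemma exists_enumeration :
    ∃ q : Fin (p + 1 - 2) → V, e ∈ missedEdges T S →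
      (∀ i : Fin (p + 1 - 2), i < g → q i ∈ Q e) ∧ Set.InjOn q {i | i < g} := by
  by_cases he : e ∈ missedEdges T S
  · have : Nonempty V := ⟨ψ (e : Sym2 τ).out.1⟩
    have hcard : #{i : Fin (p + 1 - 2) | i < g} ≤ #(Q e) := by
      rw [Fin.card_filter_val_lt, (h.isNClique e he).card_eq]
      exact min_le_right _ _
    obtain ⟨q, hq, hinj⟩ := exists_mapsTo_injOn_of_card_le hcard
    exact ⟨q, fun _ => ⟨by simpa using hq, by simpa using hinj⟩⟩
  · exact ⟨fun _ => ψ (e : Sym2 τ).out.1, fun h => absurd h he⟩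

variable {e} {q : T.edgeSet → Fin (p + 1 - 2) → V} {γ : T.edgeSet → Fin (p + 1 - 2) → Fin p}

lemma injOn_placedVertices [Fintype τ]
    (hq : ∀ e ∈ missedEdges T S, (∀ i : Fin (p + 1 - 2), i < g → q e i ∈ Q e) ∧
      Set.InjOn (q e) {i | i < g}) :
    Set.InjOn (Sum.elim ψ fun a => q a.1 a.2)
      (placedVertices T S p g : Set (τ ⊕ T.edgeSet × Fin (p + 1 - 2))) := by
  rintro (u | ⟨e, i⟩) hu (v | ⟨f, j⟩) hv huv <;>
    simp only [mem_coe, inl_mem_placedVertices, inr_mem_placedVertices, Sum.elim_inl,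
      Sum.elim_inr] at hu hv huv
  · rw [h.injOn hu hv huv]
  · exact absurd (huv ▸ (hq f hv.1).1 j hv.2) (h.notMem f hv.1 u hu)
  · exact absurd (huv ▸ (hq e hu.1).1 i hu.2) (h.notMem e hu.1 v hv)
  · obtain rfl : e = f := by_contra fun hef => disjoint_left.1
      (h.pairwiseDisjoint hu.1 hv.1 hef) ((hq e hu.1).1 i hu.2) (huv ▸ (hq f hv.1).1 j hv.2)
    rw [(hq e hu.1).2 hu.2 hv.2 huv]

lemma adj_of_mem_placedVertices [Fintype τ]
    (hq : ∀ e ∈ missedEdges T S, (∀ i : Fin (p + 1 - 2), i < g → q e i ∈ Q e) ∧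
      Set.InjOn (q e) {i | i < g}) {x y : τ ⊕ T.edgeSet × Fin (p + 1 - 2)}
    (hx : x ∈ placedVertices T S p g) (hy : y ∈ placedVertices T S p g)
    (hxy : (edgeBlowup T (p + 1)).Adj x y) :
    G.Adj (Sum.elim ψ (fun a => q a.1 a.2) x) (Sum.elim ψ (fun a => q a.1 a.2) y) := by
  obtain u | ⟨e, i⟩ := x <;> obtain v | ⟨f, j⟩ := y <;>
    simp only [inl_mem_placedVertices, inr_mem_placedVertices, edgeBlowup_adj_inl_inl,
      edgeBlowup_adj_inl_inr, edgeBlowup_adj_inr_inl, edgeBlowup_adj_inr_inr] at hx hy hxy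
  · exact absurd hxy (h.indep u hx v hy)
  · exact absurd hx (hy.1 u hxy)
  · exact absurd hy (hx.1 v hxy)
  · obtain ⟨rfl, hij⟩ := hxy
    obtain ⟨hmem, hinj⟩ := hq e hx.1
    exact (h.isNClique e hx.1).isClique (hmem i hx.2) (hmem j hy.2)
      fun heq => hij (hinj hx.2 hy.2 heq)

lemma color_ne_of_notMem_placedVertices [Fintype τ]
    (hγinj : ∀ e, Set.InjOn (γ e) {i | e ∈ missedEdges T S → g ≤ i})
    (hγ : ∀ e, ∀ i : Fin (p + 1 - 2), (e ∈ missedEdges T S → g ≤ i) →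
      ∀ u ∈ (e : Sym2 τ), u ∉ S → γ e i ≠ c u) {x y : τ ⊕ T.edgeSet × Fin (p + 1 - 2)}
    (hx : x ∉ placedVertices T S p g) (hy : y ∉ placedVertices T S p g)
    (hxy : (edgeBlowup T (p + 1)).Adj x y) :
    Sum.elim c (fun a => γ a.1 a.2) x ≠ Sum.elim c (fun a => γ a.1 a.2) y := by
  obtain u | ⟨e, i⟩ := x <;> obtain v | ⟨f, j⟩ := y <;>
    simp only [inl_mem_placedVertices, inr_mem_placedVertices, edgeBlowup_adj_inl_inl, not_and,
      not_lt, edgeBlowup_adj_inl_inr, edgeBlowup_adj_inr_inl, edgeBlowup_adj_inr_inr] at hx hy hxy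
  · exact h.color_ne u hx v hy hxy
  · exact (hγ f j hy u hxy hx).symm
  · exact hγ e i hx v hxy hy
  · obtain ⟨rfl, hij⟩ := hxy
    exact fun heq => hij (hγinj e hx hy heq)

theorem isContained [Fintype τ] {ξ L : ℝ} (hP : NearlyComplete G P ξ) (hξ : 0 ≤ ξ)
    (hL : Fintype.card (τ ⊕ T.edgeSet × Fin (p + 1 - 2)) * (ξ + 2) ≤ L)
    (hψ : ∀ s ∈ S, ∀ a, L < #(neighborsIn G (ψ s) (P a)))
    (hQ : ∀ e ∈ missedEdges T S, ∀ a ∈ I, L < #(commonNeighborsIn G (Q e) (P a)))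
    (hZ : ∀ u ∉ S, ∃ Z : Finset V, (∀ s ∈ S, T.Adj s u → ψ s ∈ Z) ∧
      (∀ e ∈ missedEdges T S, u ∈ (e : Sym2 τ) → Q e ⊆ Z) ∧
      L < #(commonNeighborsIn G Z (P (c u)))) :
    edgeBlowup T (p + 1) ⊑ G := by
  choose γ hγinj hγ using h.exists_color
  choose q hq using h.exists_enumeration
  refine isContained_of_le_card_commonNeighborsIn (S := placedVertices T S p g)
    (c := Sum.elim c fun a => γ a.1 a.2) hP hξ (h.injOn_placedVertices hq)
    (fun x hx y hy => h.adj_of_mem_placedVertices hq hx hy)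
    (fun x hx y hy => h.color_ne_of_notMem_placedVertices hγinj (fun e i hi => (hγ e i hi).1) hx hy)
    fun x hx => ?_
  suffices hcand : ∃ Z : Finset V, (∀ y ∈ placedVertices T S p g, (edgeBlowup T (p + 1)).Adj y x →
      Sum.elim ψ (fun a => q a.1 a.2) y ∈ Z) ∧
      L < #(commonNeighborsIn G Z (P (Sum.elim c (fun a => γ a.1 a.2) x))) by
    obtain ⟨Z, hmem, hlt⟩ := hcand
    refine hL.trans_lt (hlt.trans_le (Nat.cast_le.2 (card_le_card (commonNeighborsIn_anti ?_))))
    exact image_subset_iff.2 fun y hy => hmem y (mem_filter.1 hy).1 (mem_filter.1 hy).2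
  obtain u | ⟨e, i⟩ := x
  · obtain ⟨Z, hψZ, hQZ, hlt⟩ := hZ u (mt inl_mem_placedVertices.2 hx)
    refine ⟨Z, ?_, hlt⟩
    rintro (v | ⟨f, j⟩) hv hvu
    · exact hψZ v (inl_mem_placedVertices.1 hv) (edgeBlowup_adj_inl_inl.1 hvu)
    · have hf := inr_mem_placedVertices.1 hv
      exact hQZ f hf.1 (edgeBlowup_adj_inr_inl.1 hvu) ((hq f hf.1).1 j hf.2)
  · simp only [inr_mem_placedVertices, not_and, not_lt] at hx
    by_cases he : e ∈ missedEdges T S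
    · refine ⟨Q e, ?_, hQ e he _ ((hγ e i hx).2 he)⟩
      rintro (v | ⟨f, j⟩) hv hvu
      · exact absurd (inl_mem_placedVertices.1 hv) (he v (edgeBlowup_adj_inl_inr.1 hvu))
      · obtain ⟨rfl, -⟩ := edgeBlowup_adj_inr_inr.1 hvu
        exact (hq f he).1 j (inr_mem_placedVertices.1 hv).2
    · obtain ⟨s, hs, hsS⟩ : ∃ s ∈ (e : Sym2 τ), s ∈ S := by simpa [mem_missedEdges] using he
      refine ⟨{ψ s}, ?_, by rw [commonNeighborsIn_singleton]; exact hψ s hsS _⟩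
      rintro (v | ⟨f, j⟩) hv hvu
      · rw [edgeBlowup_adj_inl_inr] at hvu
        rw [inl_mem_placedVertices] at hv
        obtain rfl : v = s := by_contra fun hvs => h.indep v hv s hsS (by
          rw [← mem_edgeSet, ← (Sym2.mem_and_mem_iff hvs).1 ⟨hvu, hs⟩]
          exact e.2)
        exact mem_singleton_self _
      · obtain ⟨rfl, -⟩ := edgeBlowup_adj_inr_inr.1 hvu
        exact absurd (inr_mem_placedVertices.1 hv).1 he

end PartialPlacement

end PartialPlacement

section NearCover

/-- `S` is an independent set which covers all edges of `T` but one, namely `u₀v₀`. Every vertex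
outside `S` has at most two neighbours in `S`, and `u₀` and `v₀` have at most one. -/
structure NearCover {τ : Type*} (T : SimpleGraph τ) (S : Finset τ) (u₀ v₀ : τ) : Prop where
  adj : T.Adj u₀ v₀
  indep : ∀ u ∈ S, ∀ v ∈ S, ¬ T.Adj u v
  cover : ∀ u v, T.Adj u v → u ∉ S → v ∉ S → s(u, v) = s(u₀, v₀)
  exists_pair : ∀ u ∉ S, ∃ s ∈ S, ∃ s' ∈ S, ∀ w ∈ S, T.Adj w u → w = s ∨ w = s'
  exists_left : ∃ s ∈ S, ∀ w ∈ S, T.Adj w u₀ → w = s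
  exists_right : ∃ s ∈ S, ∀ w ∈ S, T.Adj w v₀ → w = s

variable {τ V : Type*} {T : SimpleGraph τ} {G : SimpleGraph V} {p g : ℕ} {S : Finset τ} {u₀ v₀ : τ}
  {ψ : τ → V} {Q : Finset V} {I : Finset (Fin p)} {P : Fin p → Finset V} {ξ L : ℝ}

namespace NearCover

lemma eq_of_mem_missedEdges (hT : NearCover T S u₀ v₀) {e : T.edgeSet} (he : e ∈ missedEdges T S) :
    (e : Sym2 τ) = s(u₀, v₀) := by
  obtain ⟨⟨x, y⟩, hxy⟩ := e
  exact hT.cover x y hxy (he x (Sym2.mem_mk_left x y)) (he y (Sym2.mem_mk_right x y))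

lemma partialPlacement (hT : NearCover T S u₀ v₀) (hψ : Set.InjOn ψ S) (hQ : G.IsNClique g Q)
    (hψQ : ∀ s ∈ S, ψ s ∉ Q) {c : τ → Fin p} (hne : c u₀ ≠ c v₀) (hu : c u₀ ∈ I) (hv : c v₀ ∈ I)
    (hI : p + 1 ≤ #I + g) : PartialPlacement T G S ψ g (fun _ => Q) c I where
  indep := hT.indep
  injOn := hψ
  isNClique _ _ := hQ
  pairwiseDisjoint e he f hf hef := absurd
    (Subtype.ext ((hT.eq_of_mem_missedEdges he).trans (hT.eq_of_mem_missedEdges hf).symm)) hef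
  notMem _ _ := hψQ
  color_ne u hu v hv huv := by
    obtain ⟨rfl, rfl⟩ | ⟨rfl, rfl⟩ := Sym2.eq_iff.1 (hT.cover u v huv hu hv)
    exacts [hne, hne.symm]
  color_mem u hu v hv huv := by
    obtain ⟨rfl, rfl⟩ | ⟨rfl, rfl⟩ := Sym2.eq_iff.1 (hT.cover u v huv hu hv) <;> assumption
  le_card := hI

theorem isContained [Fintype τ] (hT : NearCover T S u₀ v₀) (hP : NearlyComplete G P ξ) (hξ : 0 ≤ ξ)
    (hL : Fintype.card (τ ⊕ T.edgeSet × Fin (p + 1 - 2)) * (ξ + 2) ≤ L)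
    (hψ : Set.InjOn ψ S) (hψnb : ∀ s ∈ S, ∀ a, L < #(neighborsIn G (ψ s) (P a)))
    (hpair : ∀ s ∈ S, ∀ s' ∈ S, ∃ a, L < #(commonNeighborsIn G {ψ s, ψ s'} (P a)))
    (hQ : G.IsNClique g Q) (hψQ : ∀ s ∈ S, ψ s ∉ Q) (hI : p + 1 ≤ #I + g)
    (hQnb : ∀ a ∈ I, L < #(commonNeighborsIn G Q (P a)))
    (hends : ∀ s ∈ S, ∀ s' ∈ S, ∃ a ∈ I, ∃ b ∈ I, a ≠ b ∧
      L < #(commonNeighborsIn G (insert (ψ s) Q) (P a)) ∧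
      L < #(commonNeighborsIn G (insert (ψ s') Q) (P b))) :
    edgeBlowup T (p + 1) ⊑ G := by
  obtain ⟨s₀, hs₀, hleft⟩ := hT.exists_left
  obtain ⟨s₁, hs₁, hright⟩ := hT.exists_right
  obtain ⟨a, ha, b, hb, hab, hLa, hLb⟩ := hends s₀ hs₀ s₁ hs₁
  have hZ : ∀ u ∉ S, ∃ Z : Finset V, (∀ s ∈ S, T.Adj s u → ψ s ∈ Z) ∧
      ∃ d, L < #(commonNeighborsIn G Z (P d)) := fun u hu => by
    obtain ⟨s, hs, s', hs', h⟩ := hT.exists_pair u hu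
    refine ⟨{ψ s, ψ s'}, fun w hw hwu => ?_, hpair s hs s' hs'⟩
    obtain rfl | rfl := h w hw hwu <;> simp
  have hcolor : ∀ u, ∃ d, u ∉ S → ∃ Z : Finset V, (∀ s ∈ S, T.Adj s u → ψ s ∈ Z) ∧
      L < #(commonNeighborsIn G Z (P d)) := fun u => by
    by_cases hu : u ∈ S
    · exact ⟨a, fun h => absurd hu h⟩
    · obtain ⟨Z, hZ, d, hd⟩ := hZ u hu
      exact ⟨d, fun _ => ⟨Z, hZ, hd⟩⟩
  choose c hc using hcolor
  have huv : v₀ ≠ u₀ := hT.adj.ne'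
  have hplace : PartialPlacement T G S ψ g (fun _ => Q)
      (fun u => if u = u₀ then a else if u = v₀ then b else c u) I :=
    hT.partialPlacement hψ hQ hψQ (by simpa [huv]) (by simpa) (by simpa [huv]) hI
  refine hplace.isContained hP hξ hL hψnb (fun _ _ => hQnb) fun u hu => ?_
  by_cases hu₀ : u = u₀
  · subst hu₀
    refine ⟨insert (ψ s₀) Q, fun s hs hsu => ?_, fun _ _ _ => subset_insert _ _, by simpa⟩
    exact hleft s hs hsu ▸ mem_insert_self _ _
  by_cases hv₀ : u = v₀
  · subst hv₀
    refine ⟨insert (ψ s₁) Q, fun s hs hsu => ?_, fun _ _ _ => subset_insert _ _, by simpa [hu₀]⟩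
    exact hright s hs hsu ▸ mem_insert_self _ _
  obtain ⟨Z, hψZ, hlt⟩ := hc u hu
  refine ⟨Z, hψZ, fun e he hue => ?_, by simpa [hu₀, hv₀]⟩
  rw [hT.eq_of_mem_missedEdges he, Sym2.mem_iff] at hue
  exact absurd hue (not_or.2 ⟨hu₀, hv₀⟩)

end NearCover

theorem isContained_of_matching [Fintype τ] (hcol : T.Colorable 2) (hp : 3 ≤ p)
    (hP : NearlyComplete G P ξ) (hξ : 0 ≤ ξ)
    (hL : Fintype.card (τ ⊕ T.edgeSet × Fin (p + 1 - 2)) * (ξ + 2) ≤ L) (i : Fin p)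
    {Q : T.edgeSet → Finset V} (hQ : ∀ e, G.IsNClique 2 (Q e))
    (hdisj : Pairwise (Function.onFun Disjoint Q))
    (hnb : ∀ a, a ≠ i → L < #(commonNeighborsIn G (univ.biUnion Q) (P a))) :
    edgeBlowup T (p + 1) ⊑ G := by
  obtain ⟨a, ha, b, hb, hab⟩ : ∃ a ∈ univ.erase i, ∃ b ∈ univ.erase i, a ≠ b :=
    one_lt_card.1 (by rw [card_erase_of_mem (mem_univ i), card_univ, Fintype.card_fin]; omega)
  obtain ⟨d⟩ := hcol
  let c : τ → Fin p := fun u => ![a, b] (d u)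
  have hc : ∀ u, c u ≠ i := fun u => by
    have : ∀ x : Fin 2, ![a, b] x ≠ i :=
      Fin.forall_fin_two.2 ⟨ne_of_mem_erase ha, ne_of_mem_erase hb⟩
    exact this _
  have hinj : Function.Injective ![a, b] := by
    simp [Function.Injective, Fin.forall_fin_two, hab, hab.symm]
  obtain ⟨v, -⟩ : (commonNeighborsIn G (univ.biUnion Q) (P a)).Nonempty :=
    card_pos.1 (Nat.cast_pos.1 (((by positivity : (0 : ℝ) ≤ _).trans hL).trans_lt
      (hnb a (ne_of_mem_erase ha))))
  have hplace : PartialPlacement T G ∅ (fun _ => v) 2 Q c (univ.erase i) :=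
    { indep := by simp
      injOn := by simp
      isNClique := fun e _ => hQ e
      pairwiseDisjoint := fun e _ f _ hef => hdisj hef
      notMem := by simp
      color_ne := fun u _ w _ huw => hinj.ne (d.valid huw)
      color_mem := fun u _ _ _ _ => mem_erase.2 ⟨hc u, mem_univ _⟩
      le_card := by rw [card_erase_of_mem (mem_univ i), card_univ, Fintype.card_fin]; omega }
  refine hplace.isContained hP hξ hL (by simp) (fun e _ a ha => ?_) fun u _ =>
    ⟨univ.biUnion Q, by simp, fun e _ _ => subset_biUnion_of_mem Q (mem_univ e), hnb _ (hc u)⟩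
  exact (hnb a (ne_of_mem_erase ha)).trans_le (Nat.cast_le.2 (card_le_card
    (commonNeighborsIn_anti (subset_biUnion_of_mem Q (mem_univ e)))))

lemma exists_matching_or_cover {ι : Type*} (G : SimpleGraph V) (X : Finset V) (s : Finset ι) :
    (∃ Q : ι → Finset V, (∀ i ∈ s, G.IsNClique 2 (Q i) ∧ Q i ⊆ X) ∧
      (s : Set ι).PairwiseDisjoint Q) ∨
    ∃ Z : Finset V, #Z ≤ 2 * #s ∧ ∀ x ∈ X, ∀ y ∈ X, G.Adj x y → x ∈ Z ∨ y ∈ Z := by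
  induction s using Finset.induction_on with
  | empty => exact .inl ⟨fun _ => ∅, by simp, by simp⟩
  | insert i s hi ih =>
    rw [card_insert_of_notMem hi]
    obtain ⟨Q, hQ, hdisj⟩ | ⟨Z, hZ, hcover⟩ := ih
    swap
    · exact .inr ⟨Z, by omega, hcover⟩
    have hcard : #(s.biUnion Q) ≤ 2 * #s := by
      rw [mul_comm]
      exact card_biUnion_le_card_mul s Q 2 fun j hj => (hQ j hj).1.card_eq.le
    by_cases hcover : ∀ x ∈ X, ∀ y ∈ X, G.Adj x y → x ∈ s.biUnion Q ∨ y ∈ s.biUnion Q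
    · exact .inr ⟨_, by omega, hcover⟩
    push Not at hcover
    obtain ⟨x, hx, y, hy, hxy, hxQ, hyQ⟩ := hcover
    have hne : ∀ j ∈ s, j ≠ i := fun j hj hji => hi (hji ▸ hj)
    have hnew : ∀ j ∈ s, Disjoint {x, y} (Q j) := fun j hj => by
      have := subset_biUnion_of_mem Q hj
      rw [disjoint_insert_left, disjoint_singleton_left]
      exact ⟨fun h => hxQ (this h), fun h => hyQ (this h)⟩
    refine .inl ⟨Function.update Q i {x, y}, fun j hj => ?_, ?_⟩
    · rw [mem_insert] at hj
      obtain rfl | hj := hj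
      · rw [Function.update_self]
        exact ⟨⟨by simpa using fun _ => hxy, card_pair hxy.ne⟩, by simp [insert_subset_iff, hx, hy]⟩
      · rw [Function.update_of_ne (hne j hj)]
        exact hQ j hj
    · rw [coe_insert]
      refine Set.PairwiseDisjoint.insert (fun j hj l hl hjl => ?_) fun j hj _ => ?_
      · simp only [Function.onFun, Function.update_of_ne (hne j hj),
          Function.update_of_ne (hne l hl)]
        exact hdisj hj hl hjl
      · rw [Function.update_self, Function.update_of_ne (hne j hj)]
        exact hnew j hj

end NearCover

section WideVertices

lemma exists_forall_mem_le_card_commonNeighborsIn {η : ℝ} (hη : 0 < η) {ι : Type*} (J : Finset ι)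
    (m : ℕ) :
    ∃ c : ℕ, ∃ γ : ℝ, 0 < γ ∧ ∀ (V : Type u) [Fintype V] (G : SimpleGraph V) (P : ι → Finset V)
      (W : Finset V), c ≤ #W → (∀ w ∈ W, ∀ i, η * Fintype.card V ≤ #(neighborsIn G w (P i))) →
      ∃ S ⊆ W, #S = m ∧ ∀ j ∈ J, γ * Fintype.card V ≤ #(commonNeighborsIn G S (P j)) := by
  induction J using Finset.induction_on generalizing m with
  | empty =>
    refine ⟨m, 1, one_pos, fun V _ G P W hW _ => ?_⟩
    obtain ⟨S, hSW, hS⟩ := exists_subset_card_eq hW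
    exact ⟨S, hSW, hS, by simp⟩
  | insert a J _ ih =>
    obtain ⟨c₁, γ₁, hγ₁, h₁⟩ := ih m
    obtain ⟨c₂, γ₂, hγ₂, h₂⟩ := exists_forall_le_card_commonNeighborsIn.{u} hη c₁
    refine ⟨c₂, min γ₁ γ₂, lt_min hγ₁ hγ₂, fun V _ G P W hW hdeg => ?_⟩
    obtain ⟨S₁, hS₁W, hS₁, hcommon₁⟩ := h₂ V G (P a) W hW fun w hw => hdeg w hw a
    obtain ⟨S, hSS₁, hS, hcommon⟩ := h₁ V G P S₁ hS₁.ge fun w hw => hdeg w (hS₁W hw)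
    refine ⟨S, hSS₁.trans hS₁W, hS, (forall_mem_insert _ _ _).2 ⟨?_, fun j hj => ?_⟩⟩
    · calc min γ₁ γ₂ * Fintype.card V ≤ γ₂ * Fintype.card V := by gcongr; exact min_le_right _ _
        _ ≤ #(commonNeighborsIn G S₁ (P a)) := hcommon₁
        _ ≤ #(commonNeighborsIn G S (P a)) :=
          Nat.cast_le.2 (card_le_card (commonNeighborsIn_anti hSS₁))
    · exact (by gcongr; exact min_le_left _ _ : _ ≤ γ₁ * _).trans (hcommon j hj)

/-- The vertices with at least `d` neighbours in each of the sets `P i`. -/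
noncomputable def wideVertices {V : Type*} [Fintype V] {p : ℕ} (G : SimpleGraph V)
    (P : Fin p → Finset V) (d : ℝ) : Finset V :=
  {x | ∀ i, d ≤ #(neighborsIn G x (P i))}

lemma exists_card_wideVertices_le {η : ℝ} (hη : 0 < η) (p m : ℕ) :
    ∃ c : ℕ, ∃ γ : ℝ, 0 < γ ∧ ∀ (V : Type u) [Fintype V] (G : SimpleGraph V)
      (P : Fin p → Finset V) (ξ : ℝ), 0 ≤ ξ → NearlyComplete G P ξ →
      (completeEquipartiteGraph (p + 1) m).Free G → p * m * (ξ + 1) < γ * Fintype.card V →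
      #(wideVertices G P (η * Fintype.card V)) ≤ c := by
  obtain ⟨c, γ, hγ, h⟩ := exists_forall_mem_le_card_commonNeighborsIn.{u} hη
    (univ : Finset (Fin p)) m
  refine ⟨c, γ, hγ, fun V _ G P ξ hξ hP hfree hlt => ?_⟩
  by_contra! hcard
  obtain ⟨v, -⟩ : (wideVertices G P (η * Fintype.card V)).Nonempty := card_pos.1 (by omega)
  obtain ⟨S, -, hS, hcommon⟩ := h V G P _ hcard.le fun w hw => (mem_filter.1 hw).2
  obtain ⟨f, -, hinj, hf, hadj⟩ := exists_transversal hP hξ Prod.fst (fun _ => v)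
    (A := fun u => commonNeighborsIn G S (P u.1)) (univ : Finset (Fin p × Fin m))
    (fun u _ => commonNeighborsIn_subset)
    fun u _ => (by simpa using hlt : _ < γ * Fintype.card V).trans_le (hcommon u.1 (mem_univ _))
  refine hfree (completeEquipartiteGraph_succ_isContained (A := S)
    (B := fun j => univ.image fun l => f (j, l)) (fun i j hij x hx y hy => ?_)
    (fun j x hx y hy => ?_) hS.ge fun j => ?_)
  · simp only [coe_image, coe_univ, Set.image_univ, Set.mem_range] at hx hy
    obtain ⟨a, rfl⟩ := hx
    obtain ⟨b, rfl⟩ := hy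
    exact hadj _ (mem_univ _) _ (mem_univ _) hij
  · simp only [coe_image, coe_univ, Set.image_univ, Set.mem_range] at hy
    obtain ⟨l, rfl⟩ := hy
    exact (mem_commonNeighborsIn.1 (hf (j, l) (mem_univ _))).2 x hx
  · rw [card_image_of_injective _ fun a b hab => by simpa using hinj (by simp) (by simp) hab]
    simp

end WideVertices

section DegreeSum

variable {V : Type*} {G : SimpleGraph V}

lemma sum_card_neighborsIn_le_of_cover {X Z : Finset V} {b : ℝ} (hb : 0 ≤ b)
    (hZ : ∀ x ∈ X, ∀ y ∈ X, G.Adj x y → x ∈ Z ∨ y ∈ Z)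
    (hX : ∀ x ∈ X, (#(neighborsIn G x X) : ℝ) ≤ b) :
    ∑ x ∈ X, (#(neighborsIn G x X) : ℝ) ≤ 2 * #Z * b := by
  have hpoint : ∀ x ∈ X, (#(neighborsIn G x X) : ℝ) ≤
      #(neighborsIn G x (X ∩ Z)) + if x ∈ Z then b else 0 := fun x hx => by
    split_ifs with hxZ
    · exact (hX x hx).trans (le_add_of_nonneg_left (Nat.cast_nonneg _))
    · rw [add_zero]
      refine Nat.cast_le.2 (card_le_card fun y hy => ?_)
      rw [mem_neighborsIn] at hy ⊢
      exact ⟨mem_inter.2 ⟨hy.1, (hZ x hx y hy.1 hy.2).resolve_left hxZ⟩, hy.2⟩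
  calc ∑ x ∈ X, (#(neighborsIn G x X) : ℝ)
      ≤ ∑ x ∈ X, (#(neighborsIn G x (X ∩ Z)) + if x ∈ Z then b else 0) := sum_le_sum hpoint
    _ = ∑ y ∈ X ∩ Z, (#(neighborsIn G y X) : ℝ) + #(X ∩ Z) * b := by
      rw [sum_add_distrib, sum_ite_mem, sum_const, nsmul_eq_mul]
      congr 1
      exact_mod_cast sum_card_neighborsIn_comm G X (X ∩ Z)
    _ ≤ #(X ∩ Z) * b + #(X ∩ Z) * b := by
      gcongr
      rw [← nsmul_eq_mul]
      exact sum_le_card_nsmul _ _ _ fun y hy => hX y (mem_inter.1 hy).1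
    _ = 2 * #(X ∩ Z) * b := by ring
    _ ≤ 2 * #Z * b := by gcongr; exact inter_subset_right

lemma sum_degree_le_sum_compl [Fintype V] (G : SimpleGraph V) (W : Finset V) :
    ∑ v, G.degree v ≤ 2 * ∑ w ∈ W, G.degree w + ∑ x ∈ Wᶜ, #(neighborsIn G x Wᶜ) := by
  have hsplit : ∀ x, G.degree x ≤ #(neighborsIn G x W) + #(neighborsIn G x Wᶜ) := fun x => by
    rw [← card_neighborsIn_univ, ← union_compl W]
    exact card_neighborsIn_union_le
  have hcomm : ∑ x ∈ Wᶜ, #(neighborsIn G x W) ≤ ∑ w ∈ W, G.degree w := by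
    rw [sum_card_neighborsIn_comm]
    refine sum_le_sum fun w _ => ?_
    rw [← card_neighborsIn_univ]
    exact card_le_card (neighborsIn_mono (subset_univ _))
  calc ∑ v, G.degree v = ∑ w ∈ W, G.degree w + ∑ x ∈ Wᶜ, G.degree x :=
        (sum_add_sum_compl W _).symm
    _ ≤ ∑ w ∈ W, G.degree w +
        (∑ x ∈ Wᶜ, #(neighborsIn G x W) + ∑ x ∈ Wᶜ, #(neighborsIn G x Wᶜ)) := by
      rw [← sum_add_distrib]
      gcongr
      exact hsplit _
    _ ≤ _ := by omega

lemma sum_card_neighborsIn_le_of_subset {X A : Finset V} (hXA : X ⊆ A) :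
    ∑ x ∈ X, (#(neighborsIn G x A) : ℝ) ≤
      ∑ x ∈ X, (#(neighborsIn G x X) : ℝ) + #X * (#A - #X) := by
  have hpoint : ∀ x ∈ X, (#(neighborsIn G x A) : ℝ) ≤ #(neighborsIn G x X) + (#A - #X) :=
    fun x _ => by
      have hunion := card_neighborsIn_union_le (G := G) (x := x) (A := X) (B := A \ X)
      rw [union_sdiff_of_subset hXA] at hunion
      have hsdiff := card_le_card (neighborsIn_subset (G := G) (x := x) (A := A \ X))
      have hcard := card_sdiff_add_card_eq_card hXA
      have : #(neighborsIn G x A) + #X ≤ #(neighborsIn G x X) + #A := by omega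
      linarith [(mod_cast this : (#(neighborsIn G x A) + #X : ℝ) ≤ #(neighborsIn G x X) + #A)]
  refine (sum_le_sum hpoint).trans_eq ?_
  rw [sum_add_distrib, sum_const, nsmul_eq_mul]

lemma sum_mul_sub_le {p : ℕ} (hp : 0 < p) {a : Fin p → ℝ} {m : ℝ} (ha : ∑ i, a i = m) :
    ∑ i, a i * (m - a i) ≤ (1 - 1 / p) * m ^ 2 := by
  have hcauchy := sq_sum_le_card_mul_sum_sq (s := univ) (f := a)
  rw [ha, card_univ, Fintype.card_fin, ← div_le_iff₀' (mod_cast hp)] at hcauchy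
  calc ∑ i, a i * (m - a i) = m * m - ∑ i, a i ^ 2 := by
        nth_rw 2 [← ha]
        rw [sum_mul, ← sum_sub_distrib]
        exact sum_congr rfl fun i _ => by ring
    _ ≤ (1 - 1 / p) * m ^ 2 := by
      rw [sub_mul, one_mul, one_div_mul_eq_div]
      linarith [pow_two m]

variable [Fintype V]

/-- The vertices of colour `i` outside `W`. -/
noncomputable def colorClass {p : ℕ} (W : Finset V) (col : V → Fin p) (i : Fin p) : Finset V :=
  {x ∈ Wᶜ | col x = i}

lemma sum_degree_le {p : ℕ} (hp : 0 < p) (W : Finset V) (col : V → Fin p) {b : ℝ}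
    (hb : ∀ i, ∑ x ∈ colorClass W col i, (#(neighborsIn G x (colorClass W col i)) : ℝ) ≤ b) :
    ∑ v, (G.degree v : ℝ) ≤ 2 * ∑ w ∈ W, (G.degree w : ℝ) +
      (1 - 1 / p) * (Fintype.card V - #W) ^ 2 + p * b := by
  have hfiber : ∀ F : V → ℝ, ∑ i, ∑ x ∈ colorClass W col i, F x = ∑ x ∈ Wᶜ, F x := fun F =>
    sum_fiberwise Wᶜ col F
  have hcompl : (#Wᶜ : ℝ) = Fintype.card V - #W := by
    rw [card_compl, Nat.cast_sub (card_le_univ W)]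
  have hsum : ∑ i, (#(colorClass W col i) : ℝ) = #Wᶜ := by
    simpa using hfiber fun _ => 1
  have hinner : ∑ x ∈ Wᶜ, (#(neighborsIn G x Wᶜ) : ℝ) ≤
      p * b + (1 - 1 / p) * (#Wᶜ : ℝ) ^ 2 := by
    calc ∑ x ∈ Wᶜ, (#(neighborsIn G x Wᶜ) : ℝ)
        = ∑ i, ∑ x ∈ colorClass W col i, (#(neighborsIn G x Wᶜ) : ℝ) := (hfiber _).symm
      _ ≤ ∑ i, (b + #(colorClass W col i) * (#Wᶜ - #(colorClass W col i))) :=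
        sum_le_sum fun i _ =>
          (sum_card_neighborsIn_le_of_subset (filter_subset _ _)).trans (add_le_add_left (hb i) _)
      _ = p * b + ∑ i, (#(colorClass W col i) : ℝ) * (#Wᶜ - #(colorClass W col i)) := by
        simp [sum_add_distrib]
      _ ≤ _ := by gcongr; exact sum_mul_sub_le hp hsum
  have hdegree : ∑ v, (G.degree v : ℝ) ≤
      2 * ∑ w ∈ W, (G.degree w : ℝ) + ∑ x ∈ Wᶜ, (#(neighborsIn G x Wᶜ) : ℝ) :=
    mod_cast sum_degree_le_sum_compl G W
  rw [hcompl] at hinner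
  linarith

end DegreeSum

lemma sub_mul_le_card_commonNeighborsIn {V : Type*} {G : SimpleGraph V} (A Z : Finset V) {b : ℝ}
    (hZ : ∀ z ∈ Z, (#(nonNeighborsIn G z A) : ℝ) ≤ b) :
    #A - #Z * b ≤ (#(commonNeighborsIn G Z A) : ℝ) := by
  have hunion : (#A : ℝ) ≤ #(commonNeighborsIn G Z A) + ∑ z ∈ Z, (#(nonNeighborsIn G z A) : ℝ) :=
    mod_cast card_le_card_commonNeighborsIn_add_sum G Z A
  have hsum := sum_le_card_nsmul Z (fun z => (#(nonNeighborsIn G z A) : ℝ)) b hZ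
  rw [nsmul_eq_mul] at hsum
  linarith

section NearTuran

namespace NearTuran

variable {V : Type*} [Fintype V] {G : SimpleGraph V} {p : ℕ} {P : Fin p → Finset V} {ξ C : ℝ}

lemma le_card (h : NearTuran G P ξ C) (i : Fin p) : Fintype.card V / p - p * ξ ≤ (#(P i) : ℝ) := by
  refine sub_mul_le_card_of_sum_ge h.card_le ?_ i
  rw [mul_div_cancel₀ _ (Nat.cast_ne_zero.2 i.pos.ne')]
  exact h.le_sum_card

lemma card_nonNeighborsIn_le (h : NearTuran G P ξ C) {d : ℝ} {x : V} {i j : Fin p} (hij : i ≠ j)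
    (hx : (#(neighborsIn G x (P i)) : ℝ) < d) :
    (#(nonNeighborsIn G x (P j)) : ℝ) ≤ p * ξ + d + C :=
  card_nonNeighborsIn_le_of_card_neighborsIn_lt (h.disjoint hij) (h.le_degree x) (h.le_card i) hx

lemma card_compl_biUnion_le (h : NearTuran G P ξ C) : (#(univ.biUnion P)ᶜ : ℝ) ≤ ξ := by
  rw [card_compl, Nat.cast_sub (card_le_univ _),
    card_biUnion fun i _ j _ hij => h.disjoint hij, Nat.cast_sum]
  linarith [h.le_sum_card]

lemma card_neighborsIn_colorClass_le (h : NearTuran G P ξ C) {d : ℝ}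
    (hd : d ≤ Fintype.card V / p - (p + 1) * ξ) {W : Finset V} {col : V → Fin p}
    (hcol : ∀ x ∉ W, (#(neighborsIn G x (P (col x))) : ℝ) < d) {x : V} (hx : x ∉ W) :
    (#(neighborsIn G x (colorClass W col (col x))) : ℝ) ≤ d + ξ := by
  have hsub : neighborsIn G x (colorClass W col (col x)) ⊆
      neighborsIn G x (P (col x)) ∪ (univ.biUnion P)ᶜ := fun y hy => by
    rw [mem_neighborsIn, colorClass, mem_filter, mem_compl] at hy
    obtain ⟨⟨hyW, hyx⟩, hxy⟩ := hy
    simp only [mem_union, mem_neighborsIn, mem_compl, mem_biUnion, mem_univ, true_and]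
    by_contra! hcon
    obtain ⟨hyP, j, hj⟩ := hcon
    have hjx : j ≠ col x := by
      rintro rfl
      exact hyP hj hxy
    have hsplit : (#(neighborsIn G y (P (col x))) + #(nonNeighborsIn G y (P (col x))) : ℝ) =
        #(P (col x)) := mod_cast card_neighborsIn_add_card_nonNeighborsIn G y (P (col x))
    have hy := hcol y hyW
    rw [hyx] at hy
    linarith [h.nearlyComplete hjx y hj, h.le_card (col x)]
  have hunion : (#(neighborsIn G x (colorClass W col (col x))) : ℝ) ≤
      #(neighborsIn G x (P (col x))) + #(univ.biUnion P)ᶜ :=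
    mod_cast (card_le_card hsub).trans (card_union_le _ _)
  linarith [hcol x hx, h.card_compl_biUnion_le]

lemma exists_lt_card_commonNeighborsIn (h : NearTuran G P ξ C) (hp : 3 ≤ p) {e t : ℝ}
    (hte : (p - 1) * t < e - 2 * ξ) {x y : V}
    (hxy : (2 - 2 / p) * Fintype.card V + e ≤ (G.degree x + G.degree y : ℝ)) (a : Fin p) :
    ∃ b ≠ a, t < #(commonNeighborsIn G {x, y} (P b)) := by
  by_contra! hcon
  have hinter : (G.degree x + G.degree y : ℝ) ≤
      #(commonNeighborsIn G {x, y} univ) + Fintype.card V := by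
    have := card_union_add_card_inter (neighborsIn G x univ) (neighborsIn G y univ)
    have hle := card_le_univ (neighborsIn G x univ ∪ neighborsIn G y univ)
    have heq : neighborsIn G x univ ∩ neighborsIn G y univ = commonNeighborsIn G {x, y} univ := by
      ext z
      simp [mem_commonNeighborsIn, mem_neighborsIn]
    rw [card_neighborsIn_univ, card_neighborsIn_univ, heq] at this
    exact_mod_cast (by omega : G.degree x + G.degree y ≤ _)
  have hsub : commonNeighborsIn G {x, y} univ ⊆ (univ.biUnion P)ᶜ ∪ P a ∪
      (univ.erase a).biUnion fun b => commonNeighborsIn G {x, y} (P b) := fun z hz => by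
    rw [mem_commonNeighborsIn] at hz
    simp only [mem_union, mem_compl, mem_biUnion, mem_univ, true_and, mem_erase,
      mem_commonNeighborsIn, and_true]
    by_cases hzP : ∃ j, z ∈ P j
    · obtain ⟨j, hj⟩ := hzP
      obtain rfl | hja := eq_or_ne j a
      exacts [Or.inl (Or.inr hj), Or.inr ⟨j, hja, hj, hz.2⟩]
    · exact Or.inl (Or.inl hzP)
  have hcover : (#(commonNeighborsIn G {x, y} univ) : ℝ) ≤ #(univ.biUnion P)ᶜ + #(P a) +
      ∑ b ∈ univ.erase a, (#(commonNeighborsIn G {x, y} (P b)) : ℝ) :=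
    mod_cast (card_le_card hsub).trans ((card_union_le _ _).trans
      (Nat.add_le_add (card_union_le _ _) card_biUnion_le))
  have hsum : ∑ b ∈ univ.erase a, (#(commonNeighborsIn G {x, y} (P b)) : ℝ) ≤ (p - 1) * t := by
    have := sum_le_card_nsmul (univ.erase a)
      (fun b => (#(commonNeighborsIn G {x, y} (P b)) : ℝ)) t
      fun b hb => hcon b (mem_erase.1 hb).1
    rwa [card_erase_of_mem (mem_univ a), card_univ, Fintype.card_fin, nsmul_eq_mul,
      Nat.cast_sub a.pos, Nat.cast_one] at this
  have hthree : 3 * (Fintype.card V / p : ℝ) ≤ Fintype.card V := by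
    rw [← mul_div_assoc, div_le_iff₀ (by positivity), mul_comm]
    gcongr
    exact_mod_cast hp
  have hexpand : (2 - 2 / p) * (Fintype.card V : ℝ) =
      2 * Fintype.card V - 2 * (Fintype.card V / p) := by ring
  linarith [h.card_le a, h.card_compl_biUnion_le]

end NearTuran

lemma edgeBlowup_colorable {τ : Type*} {T : SimpleGraph τ} (hT : T.Colorable 2) {p : ℕ}
    (hp : 1 ≤ p) : (edgeBlowup T (p + 1)).Colorable (p + 1) := by
  obtain ⟨d⟩ := hT
  refine ⟨Coloring.mk (Sum.elim (fun u => ⟨d u, by omega⟩) fun a => ⟨a.2 + 2, by omega⟩) ?_⟩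
  rintro (u | ⟨e, i⟩) (v | ⟨f, j⟩) hadj
  · rw [edgeBlowup_adj_inl_inl] at hadj
    simpa [Fin.ext_iff] using d.valid hadj
  · simp only [Sum.elim_inl, Sum.elim_inr, ne_eq, Fin.mk.injEq]
    omega
  · simp only [Sum.elim_inl, Sum.elim_inr, ne_eq, Fin.mk.injEq]
    omega
  · rw [edgeBlowup_adj_inr_inr] at hadj
    simpa [Fin.ext_iff] using hadj.2

lemma completeEquipartiteGraph_free_of_free {U V : Type*} [Fintype U] {F : SimpleGraph U}
    {G : SimpleGraph V} {r : ℕ} (hF : F.Colorable r) (hfree : F.Free G) :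
    (completeEquipartiteGraph r (Fintype.card U)).Free G := fun h => by
  obtain ⟨c⟩ := hF
  exact hfree ((isContained_completeEquipartiteGraph_of_colorable c _
    fun _ => set_fintype_card_le_univ _).trans h)

end NearTuran

section Sums

variable {ι : Type*} {W : Finset ι} {f : ι → ℝ} {r : ℝ}

lemma le_card_filter_of_lt_sum {e : ℝ} {s : ℕ} (hr : 0 ≤ r) (he : 0 ≤ e) (hf : ∀ w ∈ W, f w ≤ r)
    (hsum : (s - 1) * r + #W * e < ∑ w ∈ W, f w) : s ≤ #{w ∈ W | e ≤ f w} := by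
  have hpoint : ∀ w ∈ W, f w ≤ (if e ≤ f w then r else 0) + e := fun w hw => by
    split_ifs with hew
    · linarith [hf w hw]
    · linarith
  have hle := sum_le_sum hpoint
  rw [sum_add_distrib, ← sum_filter, sum_const, sum_const, nsmul_eq_mul, nsmul_eq_mul] at hle
  by_contra! hlt
  have hcard : (#{w ∈ W | e ≤ f w} : ℝ) ≤ s - 1 := by
    rw [le_sub_iff_add_le]
    exact_mod_cast hlt
  linarith [mul_le_mul_of_nonneg_right hcard hr]

lemma sub_le_of_le_sum {δ : ℝ} (hf : ∀ w ∈ W, f w ≤ r) (hsum : #W * r - δ ≤ ∑ w ∈ W, f w) {w : ι}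
    (hw : w ∈ W) : r - δ ≤ f w := by
  have herase := sum_le_card_nsmul (W.erase w) f r fun v hv => hf v (mem_of_mem_erase hv)
  rw [nsmul_eq_mul, cast_card_erase_of_mem hw] at herase
  linarith [add_sum_erase W f hw]

end Sums

lemma le_sum_degree_sub {V : Type*} [Fintype V] {G : SimpleGraph V} {p : ℕ} (hp : 0 < p)
    {W : Finset V} {col : V → Fin p} {a b C : ℝ}
    (hb : ∀ i, ∑ x ∈ colorClass W col i, (#(neighborsIn G x (colorClass W col i)) : ℝ) ≤ b)
    (hsum : (1 - 1 / p) * (Fintype.card V : ℝ) ^ 2 + 2 * a - C ≤ ∑ v, (G.degree v : ℝ)) :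
    a - (C + (#W : ℝ) ^ 2 + p * b) / 2 ≤
      ∑ w ∈ W, (G.degree w - (1 - 1 / p) * Fintype.card V : ℝ) := by
  have hle := hsum.trans (sum_degree_le hp W col hb)
  have hexpand : (1 - 1 / p) * (Fintype.card V - #W : ℝ) ^ 2 =
      (1 - 1 / p) * (Fintype.card V : ℝ) ^ 2 - 2 * (#W * ((1 - 1 / p) * Fintype.card V)) +
        (#W : ℝ) ^ 2 - 1 / p * (#W : ℝ) ^ 2 := by ring
  have hpos : 0 ≤ 1 / p * (#W : ℝ) ^ 2 := by positivity
  rw [sum_sub_distrib, sum_const, nsmul_eq_mul]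
  linarith

section Embedding

variable {τ V : Type*} [Fintype τ] {T : SimpleGraph τ} {G : SimpleGraph V} {p : ℕ}
  {P : Fin p → Finset V} {ξ L : ℝ}

lemma sum_card_neighborsIn_le_of_free (hT : T.Colorable 2) (hp : 3 ≤ p) (hP : NearlyComplete G P ξ)
    (hξ : 0 ≤ ξ) (hL : Fintype.card (τ ⊕ T.edgeSet × Fin (p + 1 - 2)) * (ξ + 2) ≤ L)
    (hfree : (edgeBlowup T (p + 1)).Free G) {X : Finset V} {i : Fin p} {b : ℝ} (hb : 0 ≤ b)
    (hX : ∀ x ∈ X, (#(neighborsIn G x X) : ℝ) ≤ b)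
    (hnon : ∀ x ∈ X, ∀ a ≠ i, (#(nonNeighborsIn G x (P a)) : ℝ) ≤ b)
    (hlow : ∀ a ≠ i, L + 2 * Fintype.card T.edgeSet * b < #(P a)) :
    ∑ x ∈ X, (#(neighborsIn G x X) : ℝ) ≤ 2 * (2 * Fintype.card T.edgeSet) * b := by
  obtain ⟨Q, hQ, hdisj⟩ | ⟨Z, hZcard, hZ⟩ := exists_matching_or_cover G X (univ : Finset T.edgeSet)
  · have hdisj' : Pairwise (Function.onFun Disjoint Q) := fun e f hef =>
      hdisj (mem_coe.2 (mem_univ e)) (mem_coe.2 (mem_univ f)) hef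
    refine absurd (isContained_of_matching hT hp hP hξ hL i (fun e => (hQ e (mem_univ e)).1) hdisj'
      fun a ha => ?_) hfree
    have hcommon := sub_mul_le_card_commonNeighborsIn (G := G) (P a) (univ.biUnion Q)
      fun z hz => by
        obtain ⟨e, he, hze⟩ := mem_biUnion.1 hz
        exact hnon z ((hQ e he).2 hze) a ha
    have hcard : (#(univ.biUnion Q) : ℝ) ≤ 2 * Fintype.card T.edgeSet := by
      have := card_biUnion_le_card_mul univ Q 2 fun e he => (hQ e he).1.card_eq.le
      rw [card_univ, mul_comm] at this
      exact_mod_cast this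
    linarith [hlow a ha, mul_le_mul_of_nonneg_right hcard hb]
  · rw [card_univ] at hZcard
    calc ∑ x ∈ X, (#(neighborsIn G x X) : ℝ) ≤ 2 * #Z * b :=
          sum_card_neighborsIn_le_of_cover hb hZ hX
      _ ≤ 2 * (2 * Fintype.card T.edgeSet) * b := by
        gcongr
        exact_mod_cast hZcard

namespace NearCover

variable {S : Finset τ} {u₀ v₀ : τ} {ψ : τ → V}

lemma isContained_of_ne (hT : NearCover T S u₀ v₀) (hp : 0 < p) (hP : NearlyComplete G P ξ)
    (hξ : 0 ≤ ξ) (hL : Fintype.card (τ ⊕ T.edgeSet × Fin (p + 1 - 2)) * (ξ + 2) ≤ L)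
    (hψ : Set.InjOn ψ S) (hψnb : ∀ s ∈ S, ∀ a, L < #(neighborsIn G (ψ s) (P a)))
    (hcommon : ∀ s ∈ S, ∀ y a, ∃ b ≠ a, L < #(commonNeighborsIn G {ψ s, y} (P b)))
    {x : V} (hx : ∀ a, L < #(neighborsIn G x (P a))) (hψx : ∀ s ∈ S, ψ s ≠ x) :
    edgeBlowup T (p + 1) ⊑ G := by
  refine hT.isContained hP hξ hL hψ hψnb (g := 1) (Q := {x}) (I := univ) (fun s hs s' _ => ?_)
    (isNClique_singleton.2 rfl) (fun s hs => notMem_singleton.2 (hψx s hs)) (by simp)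
    (fun a _ => by rw [commonNeighborsIn_singleton]; exact hx a) fun s hs s' hs' => ?_
  · obtain ⟨b, -, hb⟩ := hcommon s hs (ψ s') ⟨0, hp⟩
    exact ⟨b, hb⟩
  · obtain ⟨a, -, ha⟩ := hcommon s hs x ⟨0, hp⟩
    obtain ⟨b, hba, hb⟩ := hcommon s' hs' x a
    exact ⟨a, mem_univ a, b, mem_univ b, hba.symm, ha, hb⟩

lemma isContained_of_adj (hT : NearCover T S u₀ v₀) (hp : 3 ≤ p) (hP : NearlyComplete G P ξ)
    (hξ : 0 ≤ ξ) (hL : Fintype.card (τ ⊕ T.edgeSet × Fin (p + 1 - 2)) * (ξ + 2) ≤ L)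
    (hψ : Set.InjOn ψ S) (hψnb : ∀ s ∈ S, ∀ a, L < #(neighborsIn G (ψ s) (P a)))
    (hcommon : ∀ s ∈ S, ∀ y a, ∃ b ≠ a, L < #(commonNeighborsIn G {ψ s, y} (P b)))
    {x y : V} (hxy : G.Adj x y) (hψx : ∀ s ∈ S, ψ s ≠ x) (hψy : ∀ s ∈ S, ψ s ≠ y) {i : Fin p}
    (htriple : ∀ s ∈ S, ∀ a ≠ i, L < #(commonNeighborsIn G {ψ s, x, y} (P a))) :
    edgeBlowup T (p + 1) ⊑ G := by
  have hcard : #(univ.erase i) = p - 1 := by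
    rw [card_erase_of_mem (mem_univ i), card_univ, Fintype.card_fin]
  obtain ⟨a, ha, b, hb, hab⟩ := one_lt_card.1 (by omega : 1 < #(univ.erase i))
  refine hT.isContained hP hξ hL hψ hψnb (g := 2) (Q := {x, y}) (I := univ.erase i)
    (fun s hs s' _ => ?_) ⟨by simpa using fun _ => hxy, card_pair hxy.ne⟩ (fun s hs => ?_)
    (by omega) (fun a ha => ?_) fun s hs s' hs' => ?_
  · obtain ⟨b, -, hb⟩ := hcommon s hs (ψ s') i
    exact ⟨b, hb⟩
  · rw [mem_insert, mem_singleton, not_or]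
    exact ⟨hψx s hs, hψy s hs⟩
  · obtain ⟨s, hs, -⟩ := hT.exists_left
    exact (htriple s hs a (ne_of_mem_erase ha)).trans_le
      (mod_cast card_le_card (commonNeighborsIn_anti (subset_insert _ _)))
  · exact ⟨a, ha, b, hb, hab, htriple s hs a (ne_of_mem_erase ha),
      htriple s' hs' b (ne_of_mem_erase hb)⟩

end NearCover

end Embedding

section Partition

/-- The hierarchy of scales `C, c², ξ, L ≪ z ≤ min d e ≪ r` for a graph which is close to a Turán
graph with `p` classes of size about `r`: `d` is the threshold for wide vertices, of which there are
at most `c`, `e` is a surplus of degree, `μ` is a number of edges, and `L` is the number of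
neighbours needed to embed greedily. -/
structure Scales (p μ c : ℕ) (r d e z ξ L C : ℝ) : Prop where
  z_pos : 0 < z
  z_le_d : z ≤ d
  z_le_e : z ≤ e
  d_le : 32 * (p * (μ * d)) ≤ r
  e_le : 4 * ((c + 1) * e) ≤ r
  ξ_nonneg : 0 ≤ ξ
  ξ_le : 64 * (p * ξ) ≤ z
  L_nonneg : 0 ≤ L
  L_le : 32 * (p * L) ≤ z
  C_le : 64 * C ≤ z
  sq_c_le : 64 * (c : ℝ) ^ 2 ≤ z

namespace Scales

variable {p μ c : ℕ} {r d e z ξ L C : ℝ}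

lemma d_pos (hs : Scales p μ c r d e z ξ L C) : 0 < d := hs.z_pos.trans_le hs.z_le_d

lemma e_pos (hs : Scales p μ c r d e z ξ L C) : 0 < e := hs.z_pos.trans_le hs.z_le_e

lemma r_pos (hs : Scales p μ c r d e z ξ L C) : 0 < r :=
  (by have := hs.e_pos; positivity : 0 < 4 * ((c + 1) * e)).trans_le hs.e_le

lemma le_p_mul (hp : 0 < p) {a : ℝ} (ha : 0 ≤ a) : a ≤ p * a :=
  le_mul_of_one_le_left ha (mod_cast hp)

lemma μ_mul_d_le (hs : Scales p μ c r d e z ξ L C) (hp : 0 < p) : 32 * (μ * d) ≤ r := by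
  linarith [hs.d_le, le_p_mul hp (mul_nonneg (Nat.cast_nonneg μ) hs.d_pos.le)]

lemma d_le_r (hs : Scales p μ c r d e z ξ L C) (hp : 0 < p) (hμ : 0 < μ) : 32 * d ≤ r := by
  linarith [hs.μ_mul_d_le hp, le_p_mul hμ hs.d_pos.le]

lemma L_lt_z (hs : Scales p μ c r d e z ξ L C) (hp : 0 < p) : L < z := by
  linarith [hs.z_pos, hs.L_le, le_p_mul hp hs.L_nonneg]

end Scales

variable {V : Type*} [Fintype V] {G : SimpleGraph V} {p μ c : ℕ} {P : Fin p → Finset V}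
  {d e z ξ L C : ℝ}

namespace NearTuran

lemma mul_div_le_card (h : NearTuran G P ξ C)
    (hs : Scales p μ c (Fintype.card V / p) d e z ξ L C) (hμ : 0 < μ) (i : Fin p) :
    15 / 16 * (Fintype.card V / p) ≤ (#(P i) : ℝ) := by
  linarith [h.le_card i, hs.ξ_le, hs.z_le_d, hs.d_le_r i.pos hμ, hs.d_pos]

lemma card_nonNeighborsIn_le_two_mul (h : NearTuran G P ξ C)
    (hs : Scales p μ c (Fintype.card V / p) d e z ξ L C) {x : V} {i j : Fin p} (hij : i ≠ j)
    (hx : (#(neighborsIn G x (P i)) : ℝ) < d) : (#(nonNeighborsIn G x (P j)) : ℝ) ≤ 2 * d := by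
  linarith [h.card_nonNeighborsIn_le hij hx, hs.ξ_le, hs.C_le, hs.z_le_d, hs.d_pos]

lemma exists_lt_card_commonNeighborsIn_of_le_degree (h : NearTuran G P ξ C)
    (hs : Scales p μ c (Fintype.card V / p) d e z ξ L C) (hp : 3 ≤ p) {x : V}
    (hx : e ≤ G.degree x - (1 - 1 / p) * Fintype.card V) (y : V) (a : Fin p) :
    ∃ b ≠ a, L < #(commonNeighborsIn G {x, y} (P b)) := by
  refine h.exists_lt_card_commonNeighborsIn hp (e := e - C) ?_ ?_ a
  · linarith [hs.L_le, hs.L_nonneg, hs.ξ_le, hs.C_le, hs.z_le_e, hs.z_pos,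
      Scales.le_p_mul a.pos hs.ξ_nonneg]
  · have hexpand : (2 - 2 / p) * (Fintype.card V : ℝ) =
        (1 - 1 / p) * Fintype.card V + (1 - 1 / p) * Fintype.card V := by ring
    linarith [h.le_degree y]

lemma lt_card_commonNeighborsIn_of_card_le_three (h : NearTuran G P ξ C)
    (hs : Scales p μ c (Fintype.card V / p) d e z ξ L C) (hμ : 0 < μ) {Z : Finset V} (hZ : #Z ≤ 3)
    {a : Fin p} (hnon : ∀ v ∈ Z, (#(nonNeighborsIn G v (P a)) : ℝ) ≤ Fintype.card V / p / 4) :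
    L < #(commonNeighborsIn G Z (P a)) := by
  have hthree : #Z * (Fintype.card V / p / 4 : ℝ) ≤ 3 * (Fintype.card V / p / 4) := by
    gcongr
    exact_mod_cast hZ
  linarith [sub_mul_le_card_commonNeighborsIn (G := G) (P a) Z hnon, h.mul_div_le_card hs hμ a,
    hs.L_lt_z a.pos, hs.z_le_d, hs.d_le_r a.pos hμ, hs.d_pos]

lemma sum_colorClass_le {τ : Type*} [Fintype τ] {T : SimpleGraph τ} (hT : T.Colorable 2)
    (h : NearTuran G P ξ C)
    (hs : Scales p (Fintype.card T.edgeSet) c (Fintype.card V / p) d e z ξ L C) (hp : 3 ≤ p)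
    (hμ : 0 < Fintype.card T.edgeSet) (hfree : (edgeBlowup T (p + 1)).Free G)
    (hL : Fintype.card (τ ⊕ T.edgeSet × Fin (p + 1 - 2)) * (ξ + 2) ≤ L)
    {W : Finset V} {col : V → Fin p}
    (hcol : ∀ x ∉ W, (#(neighborsIn G x (P (col x))) : ℝ) < d) (i : Fin p) :
    ∑ x ∈ colorClass W col i, (#(neighborsIn G x (colorClass W col i)) : ℝ) ≤
      8 * (Fintype.card T.edgeSet * d) := by
  have hp₀ : 0 < p := by omega
  have hξ := Scales.le_p_mul hp₀ hs.ξ_nonneg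
  have hd := hs.d_pos
  have hclass : ∀ x ∈ colorClass W col i, x ∉ W ∧ col x = i := fun x hx => by
    simpa [colorClass] using hx
  refine (sum_card_neighborsIn_le_of_free hT hp h.nearlyComplete hs.ξ_nonneg hL hfree
    (i := i) (b := 2 * d) (by positivity) (fun x hx => ?_) (fun x hx a ha => ?_)
    fun a _ => ?_).trans_eq (by ring)
  · obtain ⟨hxW, rfl⟩ := hclass x hx
    have hdr : d ≤ Fintype.card V / p - (p + 1) * ξ := by
      linarith [hs.d_le_r hp₀ hμ, hs.ξ_le, hs.z_le_d]
    linarith [h.card_neighborsIn_colorClass_le hdr hcol hxW, hs.ξ_le, hs.z_le_d]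
  · obtain ⟨hxW, rfl⟩ := hclass x hx
    exact h.card_nonNeighborsIn_le_two_mul hs ha.symm (hcol x hxW)
  · linarith [h.mul_div_le_card hs hμ a, hs.μ_mul_d_le hp₀, hs.L_lt_z hp₀, hs.z_le_d,
      hs.d_le_r hp₀ hμ]

end NearTuran

lemma degree_sub_le (G : SimpleGraph V) (p : ℕ) (v : V) :
    (G.degree v - (1 - 1 / p) * Fintype.card V : ℝ) ≤ Fintype.card V / p := by
  have : (G.degree v : ℝ) ≤ Fintype.card V := mod_cast (G.degree_lt_card_verts v).le
  linarith [show (1 - 1 / p) * (Fintype.card V : ℝ) = Fintype.card V - Fintype.card V / p by ring]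

lemma card_nonNeighborsIn_le_of_le_sum_degree {W : Finset V}
    (hsum : #W * (Fintype.card V / p) - Fintype.card V / p / 4 ≤
      ∑ w ∈ W, (G.degree w - (1 - 1 / p) * Fintype.card V : ℝ)) {w : V} (hw : w ∈ W)
    (A : Finset V) : (#(nonNeighborsIn G w A) : ℝ) ≤ Fintype.card V / p / 4 := by
  have hdegree := sub_le_of_le_sum (fun w _ => degree_sub_le G p w) hsum hw
  have hnon : (#(nonNeighborsIn G w A) + G.degree w : ℝ) ≤ Fintype.card V :=
    mod_cast card_nonNeighborsIn_add_degree_le G w A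
  linarith [show (1 - 1 / p) * (Fintype.card V : ℝ) = Fintype.card V - Fintype.card V / p by ring]

variable {τ : Type*} [Fintype τ] {T : SimpleGraph τ} {S : Finset τ} {u₀ v₀ : τ}

lemma NearCover.card_edgeSet_pos (hT : NearCover T S u₀ v₀) : 0 < Fintype.card T.edgeSet :=
  Fintype.card_pos_iff.2 ⟨⟨s(u₀, v₀), hT.adj⟩⟩

/-- The wide vertices with a surplus of degree form the image of a near cover, and any further wide
vertex would complete a copy of the blow-up. -/
lemma NearTuran.exists_image_eq_wideVertices (hT : NearCover T S u₀ v₀) (h : NearTuran G P ξ C)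
    (hs : Scales p μ c (Fintype.card V / p) d e z ξ L C) (hp : 3 ≤ p)
    (hfree : (edgeBlowup T (p + 1)).Free G)
    (hL : Fintype.card (τ ⊕ T.edgeSet × Fin (p + 1 - 2)) * (ξ + 2) ≤ L)
    (hc : #(wideVertices G P d) ≤ c)
    (hsum : #S * (Fintype.card V / p) - Fintype.card V / p / 4 ≤
      ∑ w ∈ wideVertices G P d, (G.degree w - (1 - 1 / p) * Fintype.card V : ℝ)) :
    ∃ ψ : τ → V, Set.InjOn ψ S ∧ S.image ψ = wideVertices G P d ∧
      ∀ s ∈ S, e ≤ G.degree (ψ s) - (1 - 1 / p) * Fintype.card V := by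
  have hV : Nonempty V := Fintype.card_pos_iff.1
    (Nat.pos_of_ne_zero fun hV => by simpa [hV] using hs.r_pos)
  have hce : #(wideVertices G P d) * e ≤ c * e := by
    have := hs.e_pos
    gcongr
  have hcard := le_card_filter_of_lt_sum (e := e) (s := #S) (by positivity) hs.e_pos.le
    (fun w _ => degree_sub_le G p w) (lt_of_lt_of_le ?_ hsum)
  swap
  · linarith [hs.e_le, hs.e_pos, hs.r_pos]
  obtain ⟨ψ, hψ, hinj⟩ := exists_mapsTo_injOn_of_card_le hcard
  have hψwide : ∀ s ∈ S, ψ s ∈ wideVertices G P d := fun s hs => (mem_filter.1 (hψ s hs)).1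
  have hwide : ∀ x ∈ wideVertices G P d, ∀ a, L < #(neighborsIn G x (P a)) := fun x hx a => by
    linarith [(mem_filter.1 hx).2 a, hs.L_lt_z a.pos, hs.z_le_d]
  refine ⟨ψ, hinj, Subset.antisymm (image_subset_iff.2 hψwide) fun x hx => ?_,
    fun s hs => (mem_filter.1 (hψ s hs)).2⟩
  by_contra hxψ
  exact hfree (hT.isContained_of_ne (by omega) h.nearlyComplete hs.ξ_nonneg hL hinj
    (fun s hs => hwide _ (hψwide s hs))
    (fun s hsS => h.exists_lt_card_commonNeighborsIn_of_le_degree hs hp (mem_filter.1 (hψ s hsS)).2)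
    (hwide x hx) fun s hs hsx => hxψ (mem_image.2 ⟨s, hs, hsx⟩))

lemma NearTuran.exists_coloring (hT : NearCover T S u₀ v₀) (hcol : T.Colorable 2)
    (h : NearTuran G P ξ C)
    (hs : Scales p (Fintype.card T.edgeSet) c (Fintype.card V / p) d e z ξ L C) (hp : 3 ≤ p)
    (hfree : (edgeBlowup T (p + 1)).Free G)
    (hL : Fintype.card (τ ⊕ T.edgeSet × Fin (p + 1 - 2)) * (ξ + 2) ≤ L)
    (hc : #(wideVertices G P d) ≤ c)
    (hsum : (1 - 1 / p) * (Fintype.card V : ℝ) ^ 2 + 2 * (#S * (Fintype.card V / p)) - C ≤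
      ∑ v, (G.degree v : ℝ)) :
    ∃ W : Finset V, #W = #S ∧
      ∃ col : V → Fin p, ∀ x ∉ W, ∀ y ∉ W, G.Adj x y → col x ≠ col y := by
  have hp₀ : 0 < p := by omega
  have hμ := hT.card_edgeSet_pos
  have hnarrow : ∀ x, ∃ i, x ∉ wideVertices G P d → (#(neighborsIn G x (P i)) : ℝ) < d :=
    fun x => by
      by_cases hx : x ∈ wideVertices G P d
      · exact ⟨⟨0, hp₀⟩, fun h => absurd hx h⟩
      · simp only [wideVertices, mem_filter, mem_univ, true_and, not_forall, not_le] at hx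
        exact hx.imp fun i hi _ => hi
  choose col hcolW using hnarrow
  have hexcess := le_sum_degree_sub hp₀
    (h.sum_colorClass_le hcol hs hp hμ hfree hL hcolW) hsum
  have hsq : (#(wideVertices G P d) : ℝ) ^ 2 ≤ (c : ℝ) ^ 2 := by gcongr
  replace hexcess : #S * (Fintype.card V / p) - Fintype.card V / p / 4 ≤
      ∑ w ∈ wideVertices G P d, (G.degree w - (1 - 1 / p) * Fintype.card V : ℝ) := by
    linarith [hs.d_le, hs.C_le, hs.sq_c_le, hs.z_le_d, hs.d_le_r hp₀ hμ, hs.d_pos]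
  obtain ⟨ψ, hinj, himage, hψdeg⟩ :=
    h.exists_image_eq_wideVertices hT hs hp hfree hL hc hexcess
  have hψwide : ∀ s ∈ S, ψ s ∈ wideVertices G P d := fun s hs => himage ▸ mem_image_of_mem ψ hs
  have hψne : ∀ x ∉ wideVertices G P d, ∀ s ∈ S, ψ s ≠ x := fun x hx s hs hsx =>
    hx (hsx ▸ hψwide s hs)
  have hcard : #(wideVertices G P d) = #S := by rw [← himage, card_image_of_injOn hinj]
  refine ⟨_, hcard, col, fun x hx y hy hxy hxycol => hfree (hT.isContained_of_adj hp
    h.nearlyComplete hs.ξ_nonneg hL hinj (fun s hsS a => ?_)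
    (fun s hsS => h.exists_lt_card_commonNeighborsIn_of_le_degree hs hp (hψdeg s hsS)) hxy
    (hψne x hx) (hψne y hy) (i := col x) fun s hsS a ha => ?_)⟩
  · linarith [(mem_filter.1 (hψwide s hsS)).2 a, hs.L_lt_z hp₀, hs.z_le_d]
  · refine h.lt_card_commonNeighborsIn_of_card_le_three hs hμ card_le_three fun v hv => ?_
    simp only [mem_insert, mem_singleton] at hv
    obtain rfl | rfl | rfl := hv
    · exact card_nonNeighborsIn_le_of_le_sum_degree (by rwa [hcard]) (hψwide s hsS) (P a)
    · linarith [h.card_nonNeighborsIn_le_two_mul hs ha.symm (hcolW _ hx), hs.d_le_r hp₀ hμ,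
        hs.d_pos]
    · linarith [h.card_nonNeighborsIn_le_two_mul hs (hxycol ▸ ha.symm) (hcolW _ hy),
        hs.d_le_r hp₀ hμ, hs.d_pos]

end Partition

section Constants

lemma exists_scales {p μ f : ℕ} (hp : 0 < p) (hf : 0 < f) (c : ℕ) {C γ η : ℝ}
    (hC : 0 ≤ C) (hγ : 0 < γ) (hη : 0 < η) (hη_le : 32 * (p * (μ * η)) ≤ 1 / p) :
    ∃ ε : ℝ, 0 < ε ∧ ∃ N : ℕ, ∀ n : ℕ, N ≤ n →
      p * f * (ε * n + 1) < γ * n ∧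
      ∃ e z : ℝ, Scales p μ c (n / p) (η * n) e z (ε * n) (f * (ε * n + 2)) C := by
  set θ : ℝ := 1 / (4 * p * (c + 1)) with hθ_def
  have hθ : 0 < θ := by positivity
  set κ := min γ (min η θ)
  have hκ : 0 < κ := lt_min hγ (lt_min hη hθ)
  set ε := κ / (64 * (p * f)) with hε_def
  have hε : 0 < ε := by positivity
  obtain ⟨N, hN⟩ := exists_nat_forall_le_mul (64 * (p * (f * 2)) + 64 * C + 64 * c ^ 2) hκ
  refine ⟨ε, hε, max 1 N, fun n hn => ?_⟩
  have hn₀ : (0 : ℝ) < n := mod_cast (by omega : 0 < n)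
  replace hN := hN n (by omega)
  have hεn : 64 * (p * f) * (ε * n) = κ * n := by rw [hε_def]; field_simp
  have hκγ : κ * n ≤ γ * n := by gcongr; exact min_le_left _ _
  have hκη : κ * n ≤ η * n := by gcongr; exact (min_le_right _ _).trans (min_le_left _ _)
  have hκθ : κ * n ≤ θ * n := by gcongr; exact (min_le_right _ _).trans (min_le_right _ _)
  have hκn : 0 < κ * n := by positivity
  have hc₀ : (0 : ℝ) ≤ (c : ℝ) ^ 2 := by positivity
  have hpf : (0 : ℝ) ≤ p * f := by positivity
  refine ⟨by linarith, θ * n, κ * n, ?_⟩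
  constructor
  case z_pos => exact hκn
  case z_le_d => exact hκη
  case z_le_e => exact hκθ
  case d_le =>
    calc 32 * (p * (μ * (η * n))) = 32 * (p * (μ * η)) * n := by ring
      _ ≤ 1 / p * n := by gcongr
      _ = n / p := by ring
  case e_le => exact le_of_eq (by rw [hθ_def]; field_simp)
  case ξ_nonneg => positivity
  case ξ_le =>
    have : p * (ε * n) ≤ p * f * (ε * n) := by
      gcongr
      exact le_mul_of_one_le_right (by positivity) (mod_cast hf)
    linarith
  case L_nonneg => positivity
  case L_le => linarith
  case C_le => linarith
  case sq_c_le => linarith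

lemma exists_coloring_of_free {τ : Type*} [Finite τ] {T : SimpleGraph τ} {S : Finset τ}
    {u₀ v₀ : τ} (hT : NearCover T S u₀ v₀) (hcol : T.Colorable 2) {p : ℕ} (hp : 3 ≤ p) {C : ℝ}
    (hC : 0 ≤ C) :
    ∃ N : ℕ, ∀ (V : Type u) [Fintype V] (G : SimpleGraph V), N ≤ Fintype.card V →
      (∀ v, (1 - 1 / p : ℝ) * Fintype.card V - C ≤ G.degree v) →
      (edgeBlowup T (p + 1)).Free G →
      (1 - 1 / p) * (Fintype.card V : ℝ) ^ 2 + 2 * (#S * (Fintype.card V / p)) - C ≤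
        ∑ v, (G.degree v : ℝ) →
      ∃ W : Finset V, #W = #S ∧
        ∃ col : V → Fin p, ∀ x ∉ W, ∀ y ∉ W, G.Adj x y → col x ≠ col y := by
  have := Fintype.ofFinite τ
  have hμ := hT.card_edgeSet_pos
  set f := Fintype.card (τ ⊕ T.edgeSet × Fin (p + 1 - 2))
  have hf : 0 < f := Fintype.card_pos_iff.2 ⟨Sum.inl u₀⟩
  set η : ℝ := 1 / (32 * p ^ 2 * Fintype.card T.edgeSet) with hη_def
  have hη : 0 < η := by positivity
  obtain ⟨c, γ, hγ, hwide⟩ := exists_card_wideVertices_le.{u} hη p f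
  obtain ⟨ε, hε, N₁, hscales⟩ := exists_scales (p := p) (μ := Fintype.card T.edgeSet) (by omega)
    hf c hC hγ hη (le_of_eq (by rw [hη_def]; field_simp))
  obtain ⟨N₂, hturan⟩ := exists_nearTuran.{u} p f (by omega) hf C hC hε
  refine ⟨max N₁ N₂, fun V _ G hn hdeg hfree hsum => ?_⟩
  have hequi := completeEquipartiteGraph_free_of_free
    (edgeBlowup_colorable hcol (by omega : 1 ≤ p)) hfree
  obtain ⟨P, hP⟩ := hturan V G (by omega) hdeg hequi
  obtain ⟨hlt, e, z, hs⟩ := hscales (Fintype.card V) (by omega)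
  exact hP.exists_coloring hT hcol hs hp hfree le_rfl
    (hwide V G P _ hs.ξ_nonneg hP.nearlyComplete hequi hlt) hsum

end Constants

section EdgeCount

variable {V W : Type*} {G : SimpleGraph V} {H : SimpleGraph W}

lemma ncard_edgeSet (G : SimpleGraph V) [Fintype G.edgeSet] : G.edgeSet.ncard = #G.edgeFinset :=
  Set.ncard_eq_toFinset_card' _

lemma ncard_edgeSet_congr (f : G ≃g H) : G.edgeSet.ncard = H.edgeSet.ncard :=
  Nat.card_congr f.mapEdgeSet

lemma two_mul_ncard_edgeSet [Fintype V] (G : SimpleGraph V) :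
    2 * G.edgeSet.ncard = ∑ v, G.degree v := by
  rw [sum_degrees_eq_twice_card_edges, ncard_edgeSet]

lemma ncard_edgeSet_le_sq [Fintype V] (G : SimpleGraph V) :
    G.edgeSet.ncard ≤ Fintype.card V ^ 2 := by
  rw [ncard_edgeSet]
  exact G.card_edgeFinset_le_card_choose_two.trans (Nat.choose_le_pow _ _)

lemma ncard_edgeSet_top [Fintype V] :
    (⊤ : SimpleGraph V).edgeSet.ncard = (Fintype.card V).choose 2 := by
  rw [ncard_edgeSet, card_edgeFinset_top_eq_card_choose_two]

lemma ncard_edgeSet_eq_induce_add_degree [Fintype V] (G : SimpleGraph V) (v : V) :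
    G.edgeSet.ncard = (G.induce {v}ᶜ).edgeSet.ncard + G.degree v := by
  have hinduce := G.card_edgeFinset_induce_compl_singleton v
  have hdelete := G.card_edgeFinset_deleteIncidenceSet v
  have hle := G.degree_le_card_edgeFinset v
  rw [ncard_edgeSet, ncard_edgeSet]
  omega

/-- If an `F`-free graph violates the conclusion, then deleting a vertex of small degree increases
the surplus of edges over `h`, and so would every further deletion until `N₀` vertices are left. -/
lemma exists_forall_le_degree_add {U : Type*} (F : SimpleGraph U) (h : ℕ → ℕ) (N₀ : ℕ)
    (hF : ∀ (V : Type u) [Fintype V] (G : SimpleGraph V), N₀ ≤ Fintype.card V → F.Free G →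
      h (Fintype.card V) ≤ G.edgeSet.ncard →
      (∀ v, h (Fintype.card V) ≤ G.degree v + h (Fintype.card V - 1)) →
      G.edgeSet.ncard = h (Fintype.card V)) :
    ∃ N : ℕ, ∀ (V : Type u) [Fintype V] (G : SimpleGraph V), N ≤ Fintype.card V → F.Free G →
      h (Fintype.card V) ≤ G.edgeSet.ncard →
      ∀ v, h (Fintype.card V) ≤ G.degree v + h (Fintype.card V - 1) := by
  have hcard : ∀ (V : Type u) [Fintype V] (v : V),
      Fintype.card ({v}ᶜ : Set V) = Fintype.card V - 1 := by
    intro V _ v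
    rw [Fintype.card_compl_set, Set.card_singleton]
  have hinduce : ∀ (V : Type u) (G : SimpleGraph V) (v : V), F.Free G →
      F.Free (G.induce {v}ᶜ) := fun V G v hG hc => hG (hc.trans ⟨Copy.induce G {v}ᶜ⟩)
  have hsurplus : ∀ n, N₀ ≤ n → ∀ (V : Type u) [Fintype V] (G : SimpleGraph V),
      Fintype.card V = n → F.Free G → h n < G.edgeSet.ncard →
      G.edgeSet.ncard + n ≤ h n + (N₀ ^ 2 + N₀) := by
    intro n hn
    induction n, hn using Nat.le_induction with
    | base =>
      rintro V _ G rfl _ _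
      have := ncard_edgeSet_le_sq G
      omega
    | succ n hn ih =>
      intro V _ G hV hG hlt
      rw [← hV] at hlt ⊢
      by_cases! hdeg : ∀ v, h (Fintype.card V) ≤ G.degree v + h (Fintype.card V - 1)
      · exact absurd (hF V G (by omega) hG hlt.le hdeg) hlt.ne'
      · obtain ⟨v, hv⟩ := hdeg
        have hdelete := ncard_edgeSet_eq_induce_add_degree G v
        obtain rfl : Fintype.card V - 1 = n := by omega
        have := ih _ (G.induce {v}ᶜ) (hcard V v) (hinduce V G v hG) (by omega)
        omega
  refine ⟨N₀ ^ 2 + N₀ + 2, fun V _ G hn hG hle v => ?_⟩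
  by_contra! hv
  have hdelete := ncard_edgeSet_eq_induce_add_degree G v
  have := hsurplus (Fintype.card V - 1) (by omega) _ (G.induce {v}ᶜ) (hcard V v)
    (hinduce V G v hG) (by omega)
  omega

lemma extremalNumber_eq_and_isExtremal_iff {U : Type*} {F : SimpleGraph U} {n : ℕ} [Fintype W]
    (hW : Fintype.card W = n) (hH : F.Free H)
    (hiso : ∀ G : SimpleGraph (Fin n), F.Free G → H.edgeSet.ncard ≤ G.edgeSet.ncard →
      Nonempty (G ≃g H)) :
    extremalNumber n F = H.edgeSet.ncard ∧
      ∀ (G : SimpleGraph (Fin n)) [DecidableRel G.Adj],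
        G.IsExtremal F.Free ↔ Nonempty (G ≃g H) := by
  have hle : extremalNumber (Fintype.card (Fin n)) F ≤ H.edgeSet.ncard := by
    refine (extremalNumber_le_iff F _).2 fun G _ hG => ?_
    rw [← ncard_edgeSet]
    by_contra! hlt
    obtain ⟨f⟩ := hiso G hG hlt.le
    exact hlt.ne' (ncard_edgeSet_congr f)
  have hge := card_edgeFinset_le_extremalNumber hH
  rw [Fintype.card_fin] at hle
  rw [hW, ← ncard_edgeSet] at hge
  have hex := hle.antisymm hge
  refine ⟨hex, fun G _ => ?_⟩
  rw [isExtremal_free_iff, Fintype.card_fin, hex, ← ncard_edgeSet]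
  refine ⟨fun h => hiso G h.1 h.2.ge, ?_⟩
  rintro ⟨f⟩
  exact ⟨(free_congr_right f).2 hH, ncard_edgeSet_congr f⟩

end EdgeCount

section Turan

variable {V : Type*} [Fintype V] {G : SimpleGraph V} {p : ℕ}

lemma ncard_edgeSet_le_turanGraph (hG : G.CliqueFree (p + 1)) :
    G.edgeSet.ncard ≤ (turanGraph (Fintype.card V) p).edgeSet.ncard := by
  rw [ncard_edgeSet, ncard_edgeSet, card_edgeFinset_turanGraph]
  exact hG.card_edgeFinset_le

lemma nonempty_iso_turanGraph_of_ncard_edgeSet_ge (hp : 0 < p) (hG : G.CliqueFree (p + 1))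
    (hle : (turanGraph (Fintype.card V) p).edgeSet.ncard ≤ G.edgeSet.ncard) :
    Nonempty (G ≃g turanGraph (Fintype.card V) p) := by
  refine (isTuranMaximal_iff_nonempty_iso_turanGraph hp).1 ⟨hG, fun H _ hH => ?_⟩
  rw [← ncard_edgeSet, ← ncard_edgeSet]
  exact (ncard_edgeSet_le_turanGraph hH).trans hle

lemma two_mul_ncard_edgeSet_turanGraph_le (m : ℕ) (hp : 0 < p) :
    2 * ((turanGraph m p).edgeSet.ncard : ℝ) ≤ (1 - 1 / p) * (m : ℝ) ^ 2 := by
  have hp₀ : (0 : ℝ) < p := mod_cast hp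
  have hnat : 2 * p * (turanGraph m p).edgeSet.ncard ≤ (p - 1) * m ^ 2 := by
    rw [ncard_edgeSet]
    exact mul_card_edgeFinset_turanGraph_le
  have hreal : (2 * p * (turanGraph m p).edgeSet.ncard : ℝ) ≤ (p - 1) * (m : ℝ) ^ 2 := by
    have : (1 : ℝ) = (1 : ℕ) := Nat.cast_one.symm
    rw [this, ← Nat.cast_sub hp]
    exact_mod_cast hnat
  rw [← mul_le_mul_iff_right₀ hp₀,
    show p * ((1 - 1 / p) * (m : ℝ) ^ 2) = (p - 1) * (m : ℝ) ^ 2 by field_simp]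
  linarith

lemma le_two_mul_ncard_edgeSet_turanGraph (m : ℕ) (hp : 0 < p) :
    (1 - 1 / p) * (m : ℝ) ^ 2 - (p ^ 2 + 2) ≤ 2 * ((turanGraph m p).edgeSet.ncard : ℝ) := by
  have hp₀ : (1 : ℝ) ≤ p := mod_cast hp
  have hmod_sq : (m % p) ^ 2 ≤ m ^ 2 := Nat.pow_le_pow_left (Nat.mod_le _ _) 2
  have hmod : ((m % p : ℕ) : ℝ) ^ 2 ≤ (p : ℝ) ^ 2 := by
    gcongr
    exact (Nat.mod_lt m hp).le
  have hnat : (m ^ 2 - (m % p) ^ 2) * (p - 1) ≤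
      2 * p * ((turanGraph m p).edgeSet.ncard + 1) := by
    refine (Nat.lt_mul_div_succ _ (by omega : 0 < 2 * p)).le.trans ?_
    gcongr
    rw [ncard_edgeSet, card_edgeFinset_turanGraph]
    exact Nat.le_add_right _ _
  have hreal : ((m : ℝ) ^ 2 - ((m % p : ℕ) : ℝ) ^ 2) * (p - 1) ≤
      2 * p * ((turanGraph m p).edgeSet.ncard + 1) := by
    have := (Nat.cast_le (α := ℝ)).2 hnat
    rwa [Nat.cast_mul, Nat.cast_sub hmod_sq, Nat.cast_sub hp, Nat.cast_mul, Nat.cast_mul,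
      Nat.cast_add, Nat.cast_pow, Nat.cast_pow, Nat.cast_one, Nat.cast_two] at this
  have hmod' : ((m % p : ℕ) : ℝ) ^ 2 * (p - 1) ≤ (p : ℝ) ^ 2 * (p - 1) := by
    gcongr
  rw [← mul_le_mul_iff_right₀ (zero_lt_one.trans_le hp₀),
    show p * ((1 - 1 / p) * (m : ℝ) ^ 2 - (p ^ 2 + 2)) = (p - 1) * (m : ℝ) ^ 2 - p * (p ^ 2 + 2) by
      field_simp]
  have : (0 : ℝ) ≤ p ^ 2 := by positivity
  linarith

end Turan

section Join

variable {V W V' W' : Type*} {G : SimpleGraph V} {H : SimpleGraph W} {G' : SimpleGraph V'}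
  {H' : SimpleGraph W'}

@[simp]
lemma join_adj_inl_inl {v w : V} : (join G H).Adj (.inl v) (.inl w) ↔ G.Adj v w := by simp [join]

@[simp]
lemma join_adj_inr_inr {v w : W} : (join G H).Adj (.inr v) (.inr w) ↔ H.Adj v w := by simp [join]

@[simp]
lemma join_adj_inl_inr {v : V} {w : W} : (join G H).Adj (.inl v) (.inr w) := by simp [join]

@[simp]
lemma join_adj_inr_inl {v : V} {w : W} : (join G H).Adj (.inr w) (.inl v) := by simp [join]

/-- The isomorphism of joins induced by isomorphisms of the summands. -/
def joinCongr (f : G ≃g G') (g : H ≃g H') : join G H ≃g join G' H' where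
  toEquiv := Equiv.sumCongr f.toEquiv g.toEquiv
  map_rel_iff' := by
    rintro (a | a) (b | b)
    · exact join_adj_inl_inl.trans (f.map_adj_iff.trans join_adj_inl_inl.symm)
    · simp
    · simp
    · exact join_adj_inr_inr.trans (g.map_adj_iff.trans join_adj_inr_inr.symm)

lemma ncard_edgeSet_join [Finite V] [Finite W] (G : SimpleGraph V) (H : SimpleGraph W) :
    (join G H).edgeSet.ncard =
      G.edgeSet.ncard + H.edgeSet.ncard + Nat.card V * Nat.card W := by
  have hsum : (G ⊕g H).edgeSet.ncard = G.edgeSet.ncard + H.edgeSet.ncard :=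
    (Nat.card_congr edgeSetSumEquiv).trans Nat.card_sum
  have hdisj : Disjoint (G ⊕g H) (completeBipartiteGraph V W) := by
    rw [← disjoint_edgeSet, Set.disjoint_left, Sym2.forall]
    rintro (a | a) (b | b) <;> simp
  have hbip : (completeBipartiteGraph V W).edgeSet.ncard = Nat.card V * Nat.card W := by
    rw [Set.ncard, encard_edgeSet_completeBipartiteGraph, ENat.toNat_mul]
    rfl
  rw [join, edgeSet_sup, Set.ncard_union_eq (disjoint_edgeSet.2 hdisj), hsum, hbip]

lemma le_join_top_comap_inr (K : SimpleGraph (V ⊕ W)) :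
    K ≤ join ⊤ (K.comap Sum.inr) := by
  rintro (a | a) (b | b) hab
  · exact join_adj_inl_inl.2 fun h => hab.ne (congrArg _ h)
  · exact join_adj_inl_inr
  · exact join_adj_inr_inl
  · exact join_adj_inr_inr.2 hab

lemma nonempty_iso_join_turanGraph [Finite V] [Fintype W] {p : ℕ} (hp : 0 < p)
    {K : SimpleGraph (V ⊕ W)} (hK : (K.comap Sum.inr).CliqueFree (p + 1))
    (hle : (join (⊤ : SimpleGraph V) (turanGraph (Fintype.card W) p)).edgeSet.ncard ≤
      K.edgeSet.ncard) :
    Nonempty (K ≃g join (⊤ : SimpleGraph V) (turanGraph (Fintype.card W) p)) := by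
  have hsub := le_join_top_comap_inr K
  have hncard := Set.ncard_le_ncard (edgeSet_subset_edgeSet.2 hsub)
  have hturan := ncard_edgeSet_le_turanGraph hK
  rw [ncard_edgeSet_join, Nat.card_fin, ← Nat.card_eq_fintype_card] at hle
  rw [ncard_edgeSet_join] at hncard
  rw [← Nat.card_eq_fintype_card] at hturan
  obtain ⟨f⟩ := nonempty_iso_turanGraph_of_ncard_edgeSet_ge hp hK
    (by rw [← Nat.card_eq_fintype_card]; omega)
  have heq : K = join ⊤ (K.comap Sum.inr) := edgeSet_inj.1 (Set.eq_of_subset_of_ncard_le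
    (edgeSet_subset_edgeSet.2 hsub) (by rw [ncard_edgeSet_join]; omega))
  exact ⟨(heq ▸ Iso.refl : K ≃g join ⊤ (K.comap Sum.inr)).trans (joinCongr Iso.refl f)⟩

end Join

section GraphH

variable {V : Type*} [Fintype V] {G : SimpleGraph V} {n p k : ℕ}

lemma numH_eq_ncard (n p q : ℕ) : numH n p q = (graphH n p q).edgeSet.ncard := by
  rw [numH, ncard_edgeSet]

lemma numH_add_one (n p k : ℕ) :
    numH n p (k + 1) =
      k.choose 2 + (turanGraph (n - k) p).edgeSet.ncard + k * (n - k) := by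
  have h := ncard_edgeSet_join (completeGraph (Fin k)) (turanGraph (n - k) p)
  rw [ncard_edgeSet_top, Fintype.card_fin, Nat.card_fin, Nat.card_fin] at h
  rw [← h, numH_eq_ncard]
  rfl

lemma le_two_mul_numH (hp : 0 < p) (hk : k ≤ n) :
    (1 - 1 / p) * (n : ℝ) ^ 2 + 2 * (k * (n / p)) - (k ^ 2 + k + (p ^ 2 + 2)) ≤
      2 * (numH n p (k + 1) : ℝ) := by
  have hturan := le_two_mul_ncard_edgeSet_turanGraph (n - k) hp
  have hsq : 0 ≤ (1 - 1 / p) * (k : ℝ) ^ 2 := mul_nonneg (Nat.one_sub_one_div_cast_nonneg p)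
    (sq_nonneg _)
  have hexpand : (1 - 1 / p) * ((n : ℝ) - k) ^ 2 = (1 - 1 / p) * (n : ℝ) ^ 2 - 2 * k * n +
      2 * (k * (n / p)) + (1 - 1 / p) * (k : ℝ) ^ 2 := by ring
  rw [Nat.cast_sub hk] at hturan
  rw [numH_add_one]
  push_cast [Nat.cast_choose_two, Nat.cast_sub hk]
  linarith

lemma le_numH_sub_numH (hp : 0 < p) (hk : k < n) :
    (1 - 1 / p) * (n : ℝ) - (p ^ 2 + 3) ≤
      (numH n p (k + 1) : ℝ) - numH (n - 1) p (k + 1) := by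
  obtain ⟨m, rfl⟩ : ∃ m, n = k + 1 + m := ⟨n - (k + 1), by omega⟩
  have hlower := le_two_mul_ncard_edgeSet_turanGraph (m + 1) hp
  have hupper := two_mul_ncard_edgeSet_turanGraph_le m hp
  have : (1 - 1 / p) * ((m : ℝ) + 1) ^ 2 - (1 - 1 / p) * (m : ℝ) ^ 2 =
      2 * ((1 - 1 / p) * (k + 1 + m)) - (1 - 1 / p) - 2 * k + 2 * (1 / p * k) := by ring
  have hk₀ : (0 : ℝ) ≤ 1 / p * k := by positivity
  have hp₀ : (0 : ℝ) ≤ 1 / p := by positivity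
  have hp_sq : (0 : ℝ) ≤ p ^ 2 := by positivity
  rw [numH_add_one, numH_add_one, show k + 1 + m - k = m + 1 by omega,
    show k + 1 + m - 1 - k = m by omega]
  push_cast at hlower ⊢
  linarith

lemma nonempty_join_iso_graphH {A B : Type*} [Fintype A] [Fintype B] (p : ℕ)
    (hA : Fintype.card A = k) (hB : Fintype.card B = n - k) :
    Nonempty (join (⊤ : SimpleGraph A) (turanGraph (Fintype.card B) p) ≃g graphH n p (k + 1)) := by
  rw [hB]
  exact ⟨joinCongr (Iso.completeGraph (Fintype.equivFinOfCardEq hA)) Iso.refl⟩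

lemma nonempty_iso_graphH (hp : 0 < p) {W : Finset V} (hW : #W = k) {col : V → Fin p}
    (hcol : ∀ x ∉ W, ∀ y ∉ W, G.Adj x y → col x ≠ col y)
    (hle : numH (Fintype.card V) p (k + 1) ≤ G.edgeSet.ncard) :
    Nonempty (G ≃g graphH (Fintype.card V) p (k + 1)) := by
  have hcompl : Fintype.card {x // x ∉ W} = Fintype.card V - k := by
    rw [Fintype.card_subtype_compl, Fintype.card_coe, hW]
  obtain ⟨f⟩ := nonempty_join_iso_graphH p ((Fintype.card_coe W).trans hW) hcompl
  let g : G.comap (Equiv.sumCompl (· ∈ W)) ≃g G := Iso.comap _ G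
  have hfree : ((G.comap (Equiv.sumCompl (· ∈ W))).comap Sum.inr).CliqueFree (p + 1) :=
    Colorable.cliqueFree ⟨Coloring.mk (fun x => col x.1) fun {x y} hxy =>
      hcol x.1 x.2 y.1 y.2 hxy⟩ (by omega)
  obtain ⟨h⟩ := nonempty_iso_join_turanGraph hp hfree
    (by rwa [ncard_edgeSet_congr f, ncard_edgeSet_congr g, ← numH_eq_ncard])
  exact ⟨g.symm.trans (h.trans f)⟩

variable {τ : Type*} [Finite τ] {T : SimpleGraph τ} {S : Finset τ} {u₀ v₀ : τ}

lemma NearCover.exists_nonempty_iso_graphH_of_degree (hT : NearCover T S u₀ v₀)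
    (hcol : T.Colorable 2) (hp : 3 ≤ p) :
    ∃ N : ℕ, ∀ (V : Type u) [Fintype V] (G : SimpleGraph V), N ≤ Fintype.card V →
      (edgeBlowup T (p + 1)).Free G → numH (Fintype.card V) p (#S + 1) ≤ G.edgeSet.ncard →
      (∀ v, numH (Fintype.card V) p (#S + 1) ≤
        G.degree v + numH (Fintype.card V - 1) p (#S + 1)) →
      Nonempty (G ≃g graphH (Fintype.card V) p (#S + 1)) := by
  obtain ⟨N, hN⟩ := exists_coloring_of_free.{u} hT hcol hp
    (C := #S ^ 2 + #S + (p ^ 2 + 3)) (by positivity)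
  refine ⟨max N (#S + 1), fun V _ G hn hfree hle hdeg => ?_⟩
  have hS : (0 : ℝ) ≤ #S ^ 2 + #S := by positivity
  have hdeg_ge (v) : (1 - 1 / p : ℝ) * Fintype.card V - (#S ^ 2 + #S + (p ^ 2 + 3)) ≤
      G.degree v := by
    have hdeg' : (numH (Fintype.card V) p (#S + 1) : ℝ) ≤
        G.degree v + numH (Fintype.card V - 1) p (#S + 1) := mod_cast hdeg v
    linarith [le_numH_sub_numH (n := Fintype.card V) (k := #S) (by omega : 0 < p) (by omega)]
  have hsum_ge : (1 - 1 / p) * (Fintype.card V : ℝ) ^ 2 + 2 * (#S * (Fintype.card V / p)) -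
      (#S ^ 2 + #S + (p ^ 2 + 3)) ≤ ∑ v, (G.degree v : ℝ) := by
    have hsum : (2 * G.edgeSet.ncard : ℝ) = ∑ v, (G.degree v : ℝ) :=
      mod_cast two_mul_ncard_edgeSet G
    have hle' : (numH (Fintype.card V) p (#S + 1) : ℝ) ≤ G.edgeSet.ncard := mod_cast hle
    linarith [le_two_mul_numH (n := Fintype.card V) (k := #S) (by omega : 0 < p) (by omega)]
  obtain ⟨W, hW, col, hcolW⟩ := hN V G (by omega) hdeg_ge hfree hsum_ge
  exact nonempty_iso_graphH (by omega) hW hcolW hle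

lemma NearCover.exists_nonempty_iso_graphH (hT : NearCover T S u₀ v₀) (hcol : T.Colorable 2)
    (hp : 3 ≤ p) :
    ∃ N : ℕ, ∀ (V : Type u) [Fintype V] (G : SimpleGraph V), N ≤ Fintype.card V →
      (edgeBlowup T (p + 1)).Free G → numH (Fintype.card V) p (#S + 1) ≤ G.edgeSet.ncard →
      Nonempty (G ≃g graphH (Fintype.card V) p (#S + 1)) := by
  obtain ⟨N₁, hN₁⟩ := hT.exists_nonempty_iso_graphH_of_degree.{u} hcol hp
  obtain ⟨N₂, hN₂⟩ := exists_forall_le_degree_add.{u} (edgeBlowup T (p + 1))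
    (fun n => numH n p (#S + 1)) N₁ fun V _ G hn hfree hle hdeg => by
      obtain ⟨f⟩ := hN₁ V G hn hfree hle hdeg
      rw [numH_eq_ncard, ncard_edgeSet_congr f]
  exact ⟨max N₁ N₂, fun V _ G hn hfree hle =>
    hN₁ V G (by omega) hfree hle (hN₂ V G (by omega) hfree hle)⟩

theorem NearCover.exists_extremalNumber_eq_and_isExtremal_iff (hT : NearCover T S u₀ v₀)
    (hcol : T.Colorable 2) (hp : 3 ≤ p)
    (hfree : ∀ n, (edgeBlowup T (p + 1)).Free (graphH n p (#S + 1))) :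
    ∃ N : ℕ, ∀ n : ℕ, N ≤ n →
      extremalNumber n (edgeBlowup T (p + 1)) = numH n p (#S + 1) ∧
      ∀ (G : SimpleGraph (Fin n)) [DecidableRel G.Adj],
        G.IsExtremal (edgeBlowup T (p + 1)).Free ↔ Nonempty (G ≃g graphH n p (#S + 1)) := by
  obtain ⟨N, hN⟩ := hT.exists_nonempty_iso_graphH hcol hp
  refine ⟨max N #S, fun n hn => ?_⟩
  rw [numH_eq_ncard]
  refine extremalNumber_eq_and_isExtremal_iff ?_ (hfree n) fun G hG hle => ?_
  · rw [Fintype.card_sum, Fintype.card_fin, Fintype.card_fin]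
    omega
  · have := hN (Fin n) G
    rw [Fintype.card_fin, numH_eq_ncard] at this
    exact this (by omega) hG hle

end GraphH

section Disjoint

variable {V W τ : Type*} {G : SimpleGraph V} {H : SimpleGraph W} {T : SimpleGraph τ} {m : ℕ}

lemma isClique_edgeClique (e : T.edgeSet) : (edgeBlowup T m).IsClique (edgeClique T m e) :=
  fun _ hx _ hy hxy => edgeBlowup_adj.2 ⟨hxy, e, hx, hy⟩

lemma exists_isNClique_subset_edgeClique (hm : 2 ≤ m) (e : T.edgeSet) :
    ∃ K : Finset (τ ⊕ T.edgeSet × Fin (m - 2)),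
      (edgeBlowup T m).IsNClique m K ∧ (K : Set _) ⊆ edgeClique T m e := by
  obtain ⟨⟨u, v⟩, huv⟩ := e
  let e : T.edgeSet := ⟨s(u, v), huv⟩
  let K := ({u, v} : Finset τ).disjSum ((univ : Finset (Fin (m - 2))).map (.sectR e _))
  have hK : (K : Set _) ⊆ edgeClique T m e := by
    rintro (w | ⟨f, i⟩) hx
    · simpa [K, e, edgeClique] using hx
    · simpa [K, edgeClique, eq_comm] using hx
  refine ⟨K, ⟨(isClique_edgeClique e).subset hK, ?_⟩, hK⟩
  rw [card_disjSum, card_pair (T.ne_of_adj huv), card_map, card_univ, Fintype.card_fin]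
  omega

lemma exists_mem_mem_of_mem_edgeClique {x : τ ⊕ T.edgeSet × Fin (m - 2)} {e f : T.edgeSet}
    (he : x ∈ edgeClique T m e) (hf : x ∈ edgeClique T m f) :
    ∃ v, v ∈ (e : Sym2 τ) ∧ v ∈ (f : Sym2 τ) := by
  obtain v | ⟨g, i⟩ := x
  · exact ⟨v, he, hf⟩
  · obtain rfl : g = e := he
    obtain rfl : g = f := hf
    exact ⟨_, Sym2.out_fst_mem _, Sym2.out_fst_mem _⟩

lemma exists_inl_mem_of_isNClique_join (hH : H.CliqueFree m) {K : Finset (V ⊕ W)}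
    (hK : (join G H).IsNClique m K) : ∃ v, Sum.inl v ∈ K := by
  by_contra! hleft
  have hleft' : K.toLeft = ∅ := eq_empty_of_forall_notMem fun v hv => hleft v (mem_toLeft.1 hv)
  refine hH K.toRight ⟨fun x hx y hy hxy => ?_, ?_⟩
  · exact join_adj_inr_inr.1 (hK.isClique (mem_toRight.1 hx) (mem_toRight.1 hy)
      (Sum.inr_injective.ne hxy))
  · rw [← hK.card_eq, ← card_toLeft_add_card_toRight (u := K), hleft', card_empty, zero_add]

/-- The cliques of pairwise disjoint edges are disjoint, and each of them has a vertex in the first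
summand of the join. -/
lemma edgeBlowup_free_join {ι : Type*} [Fintype V] [Fintype ι] (hH : H.CliqueFree m) (hm : 2 ≤ m)
    {e : ι → T.edgeSet}
    (he : Pairwise fun i j => ∀ v ∈ (e i : Sym2 τ), v ∉ (e j : Sym2 τ))
    (hcard : Fintype.card V < Fintype.card ι) : (edgeBlowup T m).Free (join G H) := by
  rintro ⟨f⟩
  have hmeet : ∀ i, ∃ x ∈ edgeClique T m (e i), ∃ v, f x = Sum.inl v := fun i => by
    obtain ⟨K, hK, hKe⟩ := exists_isNClique_subset_edgeClique hm (e i)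
    have hfK : (join G H).IsNClique m (K.map f.toEmbedding) := 
      (hK.map (f := f.toEmbedding)).mono ((map_le_iff_le_comap _ _ _).2 f.toHom.le_comap)
    obtain ⟨v, hv⟩ := exists_inl_mem_of_isNClique_join hH hfK
    obtain ⟨x, hx, hxv⟩ := mem_map.1 hv
    exact ⟨x, hKe hx, v, hxv⟩
  choose x hx v hv using hmeet
  obtain ⟨i, j, hij, hvij⟩ := Fintype.exists_ne_map_eq_of_card_lt v hcard
  have hxij : x i = x j := f.injective ((hv i).trans (hvij ▸ (hv j).symm))
  obtain ⟨w, hwi, hwj⟩ := exists_mem_mem_of_mem_edgeClique (hx i) (hxij ▸ hx j)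
  exact he hij w hwi hwj

end Disjoint

section DoubleBroom

variable {ℓ k s t : ℕ}

lemma doubleBroom_adj_inl_inl {i j : Fin ℓ} :
    (doubleBroom ℓ s t).Adj (.inl i) (.inl j) ↔ i.1 + 1 = j.1 ∨ j.1 + 1 = i.1 := by
  simp only [doubleBroom, fromRel_adj, pathGraph_adj, ne_eq, Sum.inl.injEq, Fin.ext_iff]
  omega

lemma doubleBroom_adj_inl_inr_inl {i : Fin ℓ} {x : Fin s} :
    (doubleBroom ℓ s t).Adj (.inl i) (.inr (.inl x)) ↔ i.1 = 0 := by
  simp [doubleBroom]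

lemma doubleBroom_adj_inl_inr_inr {i : Fin ℓ} {x : Fin t} :
    (doubleBroom ℓ s t).Adj (.inl i) (.inr (.inr x)) ↔ i.1 + 1 = ℓ := by
  simp [doubleBroom]

lemma not_doubleBroom_adj_inr_inr {x y : Fin s ⊕ Fin t} :
    ¬ (doubleBroom ℓ s t).Adj (.inr x) (.inr y) := by
  simp [doubleBroom]

lemma doubleBroom_colorable_two (k s t : ℕ) : (doubleBroom (2 * k) s t).Colorable 2 := by
  let c : Fin (2 * k) ⊕ (Fin s ⊕ Fin t) → Fin 2 :=
    Sum.elim (fun i => Fin.ofNat 2 i) (Sum.elim (fun _ => 1) fun _ => 0)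
  have hc : ∀ i y, (doubleBroom (2 * k) s t).Adj (.inl i) y → c (.inl i) ≠ c y := by
    rintro i (j | x | x) hij
    · rw [doubleBroom_adj_inl_inl] at hij
      simp only [c, Sum.elim_inl, ne_eq, Fin.ext_iff, Fin.val_ofNat]
      omega
    · rw [doubleBroom_adj_inl_inr_inl] at hij
      simp [c, hij]
    · rw [doubleBroom_adj_inl_inr_inr] at hij
      simp only [c, Sum.elim_inl, Sum.elim_inr, ne_eq, Fin.ext_iff, Fin.val_zero, Fin.val_ofNat]
      omega
  refine ⟨Coloring.mk c ?_⟩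
  rintro (i | x) (j | y) hxy
  · exact hc i _ hxy
  · exact hc i _ hxy
  · exact (hc j _ hxy.symm).symm
  · exact absurd hxy not_doubleBroom_adj_inr_inr

/-- The near cover of the double broom `B(2k, s, t)` by the vertices `0, 2, …, 2k - 4, 2k - 1` of
its path, which misses only the edge between `2k - 3` and `2k - 2`. -/
noncomputable def broomCover (k s t : ℕ) : Finset (Fin (2 * k) ⊕ (Fin s ⊕ Fin t)) :=
  (univ : Finset (Fin k)).image fun j =>
    .inl ⟨if j.1 + 1 < k then 2 * j.1 else 2 * k - 1, by split_ifs <;> omega⟩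

lemma card_broomCover (k s t : ℕ) : #(broomCover k s t) = k := by
  rw [broomCover, card_image_of_injective, card_univ, Fintype.card_fin]
  intro a b h
  simp only [Sum.inl.injEq, Fin.mk.injEq] at h
  ext
  split_ifs at h <;> omega

lemma inl_mem_broomCover {i : Fin (2 * k)} :
    Sum.inl i ∈ broomCover k s t ↔ (i.1 % 2 = 0 ∧ i.1 + 4 ≤ 2 * k) ∨ i.1 + 1 = 2 * k := by
  simp only [broomCover, mem_image, mem_univ, true_and, Sum.inl.injEq, Fin.ext_iff]
  constructor
  · rintro ⟨j, hj⟩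
    split_ifs at hj <;> omega
  · rintro (h | h)
    · exact ⟨⟨i.1 / 2, by omega⟩, by rw [if_pos (by dsimp only; omega)]; dsimp only; omega⟩
    · exact ⟨⟨k - 1, by omega⟩, by rw [if_neg (by dsimp only; omega)]; omega⟩

lemma inr_notMem_broomCover {x : Fin s ⊕ Fin t} : Sum.inr x ∉ broomCover k s t := by
  simp [broomCover]

lemma forall_mem_broomCover {q : Fin (2 * k) ⊕ (Fin s ⊕ Fin t) → Prop} :
    (∀ x ∈ broomCover k s t, q x) ↔
      ∀ i : Fin (2 * k), (i.1 % 2 = 0 ∧ i.1 + 4 ≤ 2 * k) ∨ i.1 + 1 = 2 * k → q (.inl i) := by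
  simp only [Sum.forall, inl_mem_broomCover, inr_notMem_broomCover, false_imp_iff, implies_true,
    and_true]

lemma not_doubleBroom_adj_of_mem_broomCover :
    ∀ x ∈ broomCover k s t, ∀ y ∈ broomCover k s t, ¬ (doubleBroom (2 * k) s t).Adj x y := by
  simp only [forall_mem_broomCover, doubleBroom_adj_inl_inl]
  omega

lemma eq_of_doubleBroom_adj_of_notMem_broomCover (hk : 2 ≤ k)
    {x y : Fin (2 * k) ⊕ (Fin s ⊕ Fin t)} (hxy : (doubleBroom (2 * k) s t).Adj x y)
    (hx : x ∉ broomCover k s t) (hy : y ∉ broomCover k s t) :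
    s(x, y) = s(.inl ⟨2 * k - 3, by omega⟩, .inl ⟨2 * k - 2, by omega⟩) := by
  have hpath : ∀ i y, (doubleBroom (2 * k) s t).Adj (.inl i) y → Sum.inl i ∉ broomCover k s t →
      y ∉ broomCover k s t → s(.inl i, y) = s(.inl ⟨2 * k - 3, by omega⟩,
        (.inl ⟨2 * k - 2, by omega⟩ : Fin (2 * k) ⊕ (Fin s ⊕ Fin t))) := by
    rintro i (j | y | y) hij hi hj <;> rw [inl_mem_broomCover] at hi
    · rw [inl_mem_broomCover] at hj
      rw [doubleBroom_adj_inl_inl] at hij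
      rw [Sym2.eq_iff]
      simp only [Sum.inl.injEq, Fin.ext_iff]
      omega
    · rw [doubleBroom_adj_inl_inr_inl] at hij
      omega
    · rw [doubleBroom_adj_inl_inr_inr] at hij
      omega
  obtain i | x := x
  · exact hpath i y hxy hx hy
  · obtain j | y := y
    · rw [Sym2.eq_swap]
      exact hpath j _ hxy.symm hy hx
    · exact absurd hxy not_doubleBroom_adj_inr_inr

lemma exists_forall_adj_eq_or_eq_of_notMem_broomCover (hk : 2 ≤ k)
    {x : Fin (2 * k) ⊕ (Fin s ⊕ Fin t)} (hx : x ∉ broomCover k s t) :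
    ∃ a ∈ broomCover k s t, ∃ b ∈ broomCover k s t,
      ∀ w ∈ broomCover k s t, (doubleBroom (2 * k) s t).Adj w x → w = a ∨ w = b := by
  simp only [forall_mem_broomCover]
  obtain i | x | x := x
  · rw [inl_mem_broomCover] at hx
    obtain hi | hi : i.1 + 3 < 2 * k ∨ 2 * k ≤ i.1 + 3 := by omega
    · refine ⟨.inl ⟨i.1 - 1, by omega⟩, inl_mem_broomCover.2 (by dsimp only; omega),
        .inl ⟨i.1 + 1, by omega⟩, inl_mem_broomCover.2 (by dsimp only; omega), ?_⟩
      simp only [doubleBroom_adj_inl_inl, Sum.inl.injEq, Fin.ext_iff]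
      omega
    · refine ⟨.inl ⟨2 * k - 4, by omega⟩, inl_mem_broomCover.2 (by dsimp only; omega),
        .inl ⟨2 * k - 1, by omega⟩, inl_mem_broomCover.2 (by dsimp only; omega), ?_⟩
      simp only [doubleBroom_adj_inl_inl, Sum.inl.injEq, Fin.ext_iff]
      omega
  · refine ⟨.inl ⟨0, by omega⟩, inl_mem_broomCover.2 (by dsimp only; omega),
      .inl ⟨0, by omega⟩, inl_mem_broomCover.2 (by dsimp only; omega), ?_⟩
    simp only [doubleBroom_adj_inl_inr_inl, Sum.inl.injEq, Fin.ext_iff]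
    omega
  · refine ⟨.inl ⟨2 * k - 1, by omega⟩, inl_mem_broomCover.2 (by dsimp only; omega),
      .inl ⟨2 * k - 1, by omega⟩, inl_mem_broomCover.2 (by dsimp only; omega), ?_⟩
    simp only [doubleBroom_adj_inl_inr_inr, Sum.inl.injEq, Fin.ext_iff]
    omega

lemma nearCover_broomCover (hk : 2 ≤ k) :
    NearCover (doubleBroom (2 * k) s t) (broomCover k s t) (.inl ⟨2 * k - 3, by omega⟩)
      (.inl ⟨2 * k - 2, by omega⟩) where
  adj := doubleBroom_adj_inl_inl.2 (by dsimp only; omega)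
  indep := not_doubleBroom_adj_of_mem_broomCover
  cover _ _ := eq_of_doubleBroom_adj_of_notMem_broomCover hk
  exists_pair _ := exists_forall_adj_eq_or_eq_of_notMem_broomCover hk
  exists_left := by
    refine ⟨.inl ⟨2 * k - 4, by omega⟩, inl_mem_broomCover.2 (by dsimp only; omega), ?_⟩
    simp only [forall_mem_broomCover, doubleBroom_adj_inl_inl, Sum.inl.injEq, Fin.ext_iff]
    omega
  exists_right := by
    refine ⟨.inl ⟨2 * k - 1, by omega⟩, inl_mem_broomCover.2 (by dsimp only; omega), ?_⟩
    simp only [forall_mem_broomCover, doubleBroom_adj_inl_inl, Sum.inl.injEq, Fin.ext_iff]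
    omega

lemma edgeBlowup_doubleBroom_free_graphH {p : ℕ} (hp : 0 < p) (hk : 0 < k) (hs : 0 < s)
    (ht : 0 < t) (n : ℕ) :
    (edgeBlowup (doubleBroom (2 * k) s t) (p + 1)).Free (graphH n p (k + 1)) := by
  -- the `i`-th of `k + 1` disjoint edges joins the path vertex `a i` to `b i`; for `i = 0`, where
  -- `2 * i - 1` truncates to `0`, and for `i = k` it is a pendant edge at an end of the path
  let a (i : Fin (k + 1)) : Fin (2 * k) ⊕ (Fin s ⊕ Fin t) := .inl ⟨2 * i.1 - 1, by omega⟩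
  let b (i : Fin (k + 1)) : Fin (2 * k) ⊕ (Fin s ⊕ Fin t) :=
    if i.1 = 0 then .inr (.inl ⟨0, hs⟩) else
      if h : i.1 < k then .inl ⟨2 * i.1, by omega⟩ else .inr (.inr ⟨0, ht⟩)
  have hadj (i : Fin (k + 1)) : (doubleBroom (2 * k) s t).Adj (a i) (b i) := by
    simp only [a, b]
    split_ifs
    · rw [doubleBroom_adj_inl_inr_inl]
      dsimp only
      omega
    · rw [doubleBroom_adj_inl_inl]
      dsimp only
      omega
    · rw [doubleBroom_adj_inl_inr_inr]
      dsimp only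
      omega
  refine edgeBlowup_free_join (turanGraph_cliqueFree hp) (by omega)
    (e := fun i => ⟨s(a i, b i), hadj i⟩) ?_ (by simp)
  intro i j hij v hvi hvj
  have hij' : i.1 ≠ j.1 := Fin.val_ne_of_ne hij
  simp only [Sym2.mem_iff, a, b] at hvi hvj
  obtain rfl | rfl := hvi <;> split_ifs at hvj <;> simp at hvj <;> omega

end DoubleBroom

end EdgeBlowup

open SimpleGraph EdgeBlowup in
theorem corollary1p5_general (p k s t : ℕ) (hp : 3 ≤ p) (hk : 2 ≤ k) (hs : 0 < s) (ht : 0 < t) :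
    ∃ N : ℕ, ∀ n : ℕ, N ≤ n →
      extremalNumber n (edgeBlowup (doubleBroom (2 * k) s t) (p + 1)) = numH n p (k + 1) ∧
      ∀ (G : SimpleGraph (Fin n)) [DecidableRel G.Adj],
        G.IsExtremal (edgeBlowup (doubleBroom (2 * k) s t) (p + 1)).Free ↔
          Nonempty (G ≃g graphH n p (k + 1)) := by
  have h := (nearCover_broomCover (s := s) (t := t) hk).exists_extremalNumber_eq_and_isExtremal_iff
    (doubleBroom_colorable_two k s t) hp
  rw [card_broomCover] at h
  exact h fun n => edgeBlowup_doubleBroom_free_graphH (by omega) (by omega) hs ht n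

theorem corollary1p5 (p k s t : ℕ) (hp : 3 ≤ p) (hk : 2 ≤ k) (hs : 2 ≤ s) (ht : 2 ≤ t) :
    ∃ N : ℕ, ∀ n : ℕ, N ≤ n →
      SimpleGraph.extremalNumber n
          (EdgeBlowup.edgeBlowup (EdgeBlowup.doubleBroom (2 * k) s t) (p + 1)) =
        EdgeBlowup.numH n p (k + 1) ∧
      ∀ (G : SimpleGraph (Fin n)) [DecidableRel G.Adj],
        G.IsExtremal
            (EdgeBlowup.edgeBlowup (EdgeBlowup.doubleBroom (2 * k) s t) (p + 1)).Free ↔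
          Nonempty (G ≃g EdgeBlowup.graphH n p (k + 1)) :=
  corollary1p5_general p k s t hp hk (by omega) (by omega)
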